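/- Let $\mathbb N=\{1,2,3,\dots\}$. For $j\in\mathbb N$ let $S_j(x)=\frac{1}{2^{j+1}}x+1-\frac{1}{2^{j-1}}$ $(x\in\mathbb R)$, and let $p_1=\frac14$ and $p_j=\frac{3}{2^{j+1}}$ for $j\ge 2$. Let $P$ be the unique Borel probability measure on $\mathbb R$ with $P=\sum_{j=1}^\infty p_j\,P\circ S_j^{-1}$. Put $J_j=S_j([0,1])$ and $J_{(k,\infty)}=\bigcup_{j=1}^\infty J_{k+j}$ for $j,k\in\mathbb N$. A set $\alpha\subset\mathbb R$ with $1\le\operatorname{card}(\alpha)\le n$ is called an optimal set of $n$-means for $P$ if $\int\min_{a\in\alpha}(x-a)^2\,dP(x)$ equals the infimum of $\int\min_{b\in\beta}(x-b)^2\,dP(x)$ over all $\beta\subset\mathbb R$ with $1\le\operatorname{card}(\beta)\le n$. The Voronoi region of $a\in\alpha$ is $M(a|\alpha)=\{x\in\mathbb R : |x-a|\le|x-b|\text{ for all }b\in\alpha\}$. Let $n,k\in\mathbb N$ and let $\alpha_n$ be an optimal set of $n$-means for $P$ such that $\operatorname{card}(\alpha_n\cap J_{(k,\infty)})\ge 2$.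 Then $\alpha_n\cap J_{k+1}\ne\emptyset$, $\alpha_n\cap J_{(k+1,\infty)}\neq\emptyset$, and $\alpha_n$ contains no point of the open interval $(S_{k+1}(1),S_{k+2}(0))$. Moreover, the Voronoi region of any point of $\alpha_n\cap J_{k+1}$ contains no point of $J_{(k+1,\infty)}$, and the Voronoi region of any point of $\alpha_n\cap J_{(k+1,\infty)}$ contains no point of $J_{k+1}$. -/

import Mathlib

open MeasureTheory
open scoped ENNReal

namespace InfQuant

/-- The similarity mapping with index `j ≥ 1` on the real line, of ratio `1 / 2 ^ (j + 1)`. -/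
noncomputable def S (j : ℕ) (x : ℝ) : ℝ := 1 / 2 ^ (j + 1) * x + 1 - 1 / 2 ^ (j - 1)

/-- The probability attached to the index `j ≥ 1`: `1 / 4, 3 / 2 ^ 3, 3 / 2 ^ 4, …`. -/
noncomputable def prob (j : ℕ) : ℝ := if j = 1 then 1 / 4 else 3 / 2 ^ (j + 1)

/-- `μ` is a Borel probability measure on the line with `μ = ∑_{j ≥ 1} prob j • (μ ∘ (S j)⁻¹)`. -/
def IsSelfSimilar (μ : Measure ℝ) : Prop :=
  IsProbabilityMeasure μ ∧
    μ = Measure.sum fun j : ℕ => ENNReal.ofReal (prob (j + 1)) • μ.map (S (j + 1))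

/-! ### Existence and uniqueness of the self-similar measure -/

lemma measurable_S (j : ℕ) : Measurable (S j) := by
  unfold S; fun_prop

lemma prob_nonneg (j : ℕ) : 0 ≤ prob j := by
  unfold prob; split_ifs <;> positivity

lemma hasSum_prob : HasSum (fun j : ℕ => prob (j + 1)) 1 := by
  have h := (hasSum_geometric_two).mul_left (3 / 8 : ℝ)
  have e : (fun n : ℕ => (3 / 8 : ℝ) * (1 / 2) ^ n) = fun n : ℕ => prob (n + 1 + 1) := by
    funext j
    simp only [prob, Nat.succ_ne_zero, Nat.add_eq_right, if_false, pow_succ, one_div, inv_pow]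
    field_simp
    norm_num
  rw [e] at h
  have h2 := (hasSum_nat_add_iff (f := fun j : ℕ => prob (j + 1)) 1).1 h
  convert! h2 using 1
  norm_num [prob]

lemma tsum_ofReal_prob : ∑' j : ℕ, ENNReal.ofReal (prob (j + 1)) = 1 := by
  rw [← ENNReal.ofReal_tsum_of_nonneg (fun j => prob_nonneg _) hasSum_prob.summable,
    hasSum_prob.tsum_eq, ENNReal.ofReal_one]

/-- The law of a random index, shifted so that `j` stands for the index `j + 1`. -/
noncomputable def letterLaw : Measure ℕ :=
  Measure.sum fun j : ℕ => ENNReal.ofReal (prob (j + 1)) • Measure.dirac j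

instance : IsProbabilityMeasure letterLaw := by
  refine ⟨?_⟩
  simp [letterLaw, tsum_ofReal_prob]

/-- The point of the line coded by an infinite sequence of indices. -/
noncomputable def coding (ω : ℕ → ℕ) : ℝ :=
  ∑' n : ℕ, (∏ i ∈ Finset.range n, (1 / 2 ^ (ω i + 2) : ℝ)) * (1 - 1 / 2 ^ ω n)

/-- Prepend a letter to an infinite sequence. -/
def prepend (q : ℕ × (ℕ → ℕ)) : ℕ → ℕ := fun n => Nat.casesOn n q.1 q.2

lemma measurable_prepend : Measurable prepend := by
  refine measurable_pi_lambda _ fun n => ?_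
  cases n with
  | zero => exact measurable_fst
  | succ n => exact (measurable_pi_apply n).comp measurable_snd

lemma summable_coding (ω : ℕ → ℕ) :
    Summable fun n : ℕ =>
      (∏ i ∈ Finset.range n, (1 / 2 ^ (ω i + 2) : ℝ)) * (1 - 1 / 2 ^ ω n) := by
  have h1 : ∀ m : ℕ, (1 / 2 ^ m : ℝ) ≤ 1 := fun m => by
    rw [div_le_one (by positivity)]; exact one_le_pow₀ (by norm_num)
  refine Summable.of_nonneg_of_le (fun n => ?_) (fun n => ?_)
    (summable_geometric_of_lt_one (r := (1 / 4 : ℝ)) (by norm_num) (by norm_num))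
  · exact mul_nonneg (Finset.prod_nonneg fun i _ => by positivity) (by linarith [h1 (ω n)])
  · have h2 : (∏ i ∈ Finset.range n, (1 / 2 ^ (ω i + 2) : ℝ)) ≤ (1 / 4) ^ n := by
      calc _ ≤ ∏ i ∈ Finset.range n, (1 / 4 : ℝ) := by
            refine Finset.prod_le_prod (fun i _ => by positivity) fun i _ => ?_
            refine one_div_le_one_div_of_le (by norm_num) ?_
            have : (1 : ℝ) ≤ 2 ^ ω i := one_le_pow₀ (by norm_num)
            rw [pow_add]; linarith
        _ = _ := by simp
    have h3 : (0 : ℝ) ≤ 1 / 2 ^ ω n := by positivity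
    have h4 : (0 : ℝ) ≤ ∏ i ∈ Finset.range n, (1 / 2 ^ (ω i + 2) : ℝ) :=
      Finset.prod_nonneg fun i _ => by positivity
    nlinarith [h1 (ω n)]

lemma measurable_coding : Measurable coding := by
  unfold coding
  refine Measurable.tsum fun n => ?_
  fun_prop

lemma coding_prepend (j : ℕ) (ω : ℕ → ℕ) : coding (prepend (j, ω)) = S (j + 1) (coding ω) := by
  unfold coding
  rw [(summable_coding _).tsum_eq_zero_add]
  simp only [Finset.prod_range_succ', S, prepend, Finset.range_zero, Finset.prod_empty, one_mul]
  rw [← tsum_mul_left]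
  simp only [Nat.add_sub_cancel]
  have : ∀ a b c d : ℝ, a = d → 1 - b + a = d + 1 - b := fun a b c d h => by rw [h]; ring
  refine this _ _ 0 _ (tsum_congr fun n => ?_)
  change _ * (1 / 2 ^ (j + 2)) * _ = _
  ring

lemma map_prepend :
    (letterLaw.prod (Measure.infinitePi fun _ : ℕ => letterLaw)).map prepend =
      Measure.infinitePi fun _ : ℕ => letterLaw := by
  refine Measure.eq_infinitePi _ fun s t ht => ?_
  classical
  obtain ⟨N, hN⟩ := s.exists_nat_subset_range
  set u : ℕ → Set ℕ := fun i => if i ∈ s then t i else Set.univ with hu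
  have hum : ∀ i, MeasurableSet (u i) := fun i => MeasurableSet.of_discrete
  have e1 : Set.pi (s : Set ℕ) t = Set.pi (Finset.range (N + 1) : Set ℕ) u := by
    ext x
    simp only [Set.mem_pi, Finset.mem_coe, hu]
    constructor
    · intro h i _
      split_ifs with hi
      · exact h i hi
      · trivial
    · intro h i hi
      have := h i (Finset.range_mono (Nat.le_succ N) (hN hi))
      rwa [if_pos hi] at this
  have e2 : ∏ i ∈ s, letterLaw (t i) = ∏ i ∈ Finset.range (N + 1), letterLaw (u i) := by
    have hs : s ⊆ Finset.range (N + 1) := hN.trans (Finset.range_mono (Nat.le_succ N))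
    rw [← Finset.prod_subset hs (f := fun i => letterLaw (u i))]
    · exact Finset.prod_congr rfl fun i hi => by simp [hu, hi]
    · intro i _ hi
      simp [hu, hi]
  have e3 : prepend ⁻¹' Set.pi (Finset.range (N + 1) : Set ℕ) u =
      u 0 ×ˢ Set.pi (Finset.range N : Set ℕ) fun i => u (i + 1) := by
    ext ⟨j, ω⟩
    simp only [Set.mem_preimage, Set.mem_pi, Finset.coe_range, Set.mem_Iio, Set.mem_prod]
    constructor
    · exact fun h => ⟨h 0 (Nat.succ_pos _), fun i hi => h (i + 1) (by omega)⟩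
    · rintro ⟨h0, h⟩ i hi
      cases i with
      | zero => exact h0
      | succ i => exact h i (by omega)
  rw [e2, e1, Measure.map_apply measurable_prepend
    (MeasurableSet.pi (Finset.range (N + 1)).countable_toSet fun i _ => hum i), e3,
    Measure.prod_prod, Measure.infinitePi_pi _ (fun i _ => hum _), Finset.prod_range_succ',
    mul_comm]

lemma exists_isSelfSimilar : ∃ μ : Measure ℝ, IsSelfSimilar μ := by
  set π : Measure (ℕ → ℕ) := Measure.infinitePi fun _ : ℕ => letterLaw with hπ
  refine ⟨π.map coding, Measure.isProbabilityMeasure_map measurable_coding.aemeasurable, ?_⟩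
  conv_lhs => rw [hπ, ← map_prepend, ← hπ]
  rw [Measure.map_map measurable_coding measurable_prepend, letterLaw, Measure.prod_sum_left,
    Measure.map_sum (measurable_coding.comp measurable_prepend).aemeasurable]
  congr 1
  funext j
  rw [Measure.prod_smul_left, Measure.dirac_prod, Measure.map_smul,
    Measure.map_map (measurable_coding.comp measurable_prepend) measurable_prodMk_left,
    Measure.map_map (measurable_S _) measurable_coding]
  congr 2
  funext ω
  exact coding_prepend j ω

lemma charFun_map_S (μ : Measure ℝ) (j : ℕ) (t : ℝ) :
    charFun (μ.map (S j)) t =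
      Complex.exp (t * ((1 - 1 / 2 ^ (j - 1) : ℝ) : ℂ) * Complex.I) *
        charFun μ (t / 2 ^ (j + 1)) := by
  rw [charFun_apply_real, charFun_apply_real,
    integral_map (measurable_S j).aemeasurable (by fun_prop), ← integral_const_mul]
  congr 1
  funext x
  rw [← Complex.exp_add]
  congr 1
  simp only [S]
  push_cast
  ring

lemma hasSum_charFun {μ : Measure ℝ} (h : IsSelfSimilar μ) (t : ℝ) :
    HasSum (fun j : ℕ => (prob (j + 1) : ℂ) * charFun (μ.map (S (j + 1))) t) (charFun μ t) := by
  have := h.1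
  have hi : Integrable (fun x : ℝ => Complex.exp (t * x * Complex.I)) μ := by
    refine Integrable.of_bound (by fun_prop) 1 (ae_of_all _ fun x => ?_)
    rw [← Complex.ofReal_mul, Complex.norm_exp_ofReal_mul_I]
  have hs := hi
  rw [h.2] at hs
  have h1 := hasSum_integral_measure hs
  rw [← h.2, ← charFun_apply_real] at h1
  refine h1.congr_fun ?_
  intro j
  rw [integral_smul_measure, ENNReal.toReal_ofReal (prob_nonneg _), charFun_apply_real]
  simp

lemma IsSelfSimilar.unique {μ ν : Measure ℝ} (hμ : IsSelfSimilar μ) (hν : IsSelfSimilar ν) :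
    μ = ν := by
  have := hμ.1
  have := hν.1
  refine Measure.ext_of_charFun (funext fun t => ?_)
  set D : ℝ → ℂ := fun t => charFun μ t - charFun ν t with hD
  have step : ∀ ε r : ℝ, (∀ t, |t| ≤ r → ‖D t‖ ≤ ε) → ∀ t, |t| ≤ 4 * r → ‖D t‖ ≤ ε := by
    intro ε r h t ht
    have h1 := (hasSum_charFun hμ t).sub (hasSum_charFun hν t)
    have h2 := hasSum_prob.mul_right ε
    rw [one_mul] at h2
    refine h1.norm_le_of_bounded h2 fun j => ?_
    rw [← mul_sub, charFun_map_S, charFun_map_S, ← mul_sub, norm_mul, norm_mul,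
      Complex.norm_real, Real.norm_of_nonneg (prob_nonneg _), ← Complex.ofReal_mul,
      Complex.norm_exp_ofReal_mul_I, one_mul]
    refine mul_le_mul_of_nonneg_left (h _ ?_) (prob_nonneg _)
    have h4 : (4 : ℝ) ≤ 2 ^ (j + 1 + 1) := by
      have : (1 : ℝ) ≤ 2 ^ j := one_le_pow₀ (by norm_num)
      rw [pow_succ, pow_succ]; linarith
    rw [abs_div, abs_of_pos (by positivity : (0 : ℝ) < 2 ^ (j + 1 + 1)),
      div_le_iff₀ (by positivity)]
    have hr : 0 ≤ r := by linarith [abs_nonneg t]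
    nlinarith
  have hcont : Continuous D := continuous_charFun.sub continuous_charFun
  have hD0 : D 0 = 0 := by simp [hD]
  have key : D t = 0 := by
    rw [← norm_le_zero_iff]
    refine le_of_forall_pos_le_add fun ε hε => ?_
    rw [zero_add]
    obtain ⟨δ, hδ, hb⟩ := Metric.continuous_iff.1 hcont 0 ε hε
    have base : ∀ n : ℕ, ∀ t, |t| ≤ 4 ^ n * (δ / 2) → ‖D t‖ ≤ ε := by
      intro n
      induction n with
      | zero =>
        intro t ht
        have := hb t (by rw [Real.dist_eq, sub_zero]; linarith)
        rw [hD0, dist_zero_right] at this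
        exact this.le
      | succ n ih =>
        intro t ht
        exact step ε _ ih t (by rw [← mul_assoc, ← pow_succ']; exact ht)
    obtain ⟨n, hn⟩ := pow_unbounded_of_one_lt (|t| / (δ / 2)) (by norm_num : (1 : ℝ) < 4)
    exact base n t ((div_lt_iff₀ (by positivity)).1 hn).le
  exact sub_eq_zero.1 key

theorem existsUnique_isSelfSimilar : ∃! μ : Measure ℝ, IsSelfSimilar μ := by
  obtain ⟨μ, hμ⟩ := exists_isSelfSimilar
  exact ⟨μ, hμ, fun ν hν => hν.unique hμ⟩

/-- The unique Borel probability measure `P` with `P = ∑_{j ≥ 1} prob j • (P ∘ (S j)⁻¹)`. -/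
noncomputable def P : Measure ℝ := existsUnique_isSelfSimilar.choose

theorem isSelfSimilar_P : IsSelfSimilar P := existsUnique_isSelfSimilar.choose_spec.1

/-! ### Basic intervals -/

/-- The basic interval `S j [0, 1]`. -/
def J (j : ℕ) : Set ℝ := S j '' Set.Icc 0 1

/-- The union of the basic intervals with index larger than `k`. -/
def JTail (k : ℕ) : Set ℝ := ⋃ j : ℕ, J (k + (j + 1))

/-! ### Quantization -/

/-- The distortion error `∫ min_{a ∈ α} (x - a)² dμ` (it is `∞` when `α` is empty
and `μ` is not zero). -/
noncomputable def distortion (μ : Measure ℝ) (α : Finset ℝ) : ℝ≥0∞ :=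
  ∫⁻ x, ⨅ a ∈ α, ENNReal.ofReal ((x - a) ^ 2) ∂μ

/-- The `n`th quantization error: the infimum of the distortion errors over all sets with
at least one and at most `n` points. -/
noncomputable def quantError (μ : Measure ℝ) (n : ℕ) : ℝ≥0∞ :=
  ⨅ (α : Finset ℝ) (_ : 1 ≤ α.card ∧ α.card ≤ n), distortion μ α

/-- `α` is an optimal set of `n`-means for `μ`. -/
def IsOptimalSet (μ : Measure ℝ) (n : ℕ) (α : Finset ℝ) : Prop :=
  (1 ≤ α.card ∧ α.card ≤ n) ∧ distortion μ α = quantError μ n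

/-- The Voronoi region of `a` with respect to `α`. -/
def voronoi (α : Finset ℝ) (a : ℝ) : Set ℝ := {x | ∀ b ∈ α, |x - a| ≤ |x - b|}

end InfQuant

namespace InfQuant

/-! ### The reflected law, its tail and its first block -/

/-! In the coordinate y = 2^(k+2) (1 - x) the interval J_{k+1} becomes [3, 4], the later intervals
lie in [0, 2] and the earlier ones in [6, ∞). Up to a positive factor, P becomes T + θ B + ρ, where
T (`tailLaw`) and B (`blockLaw`) are probability laws independent of k and ρ is carried by [6, ∞).
Here θ = 1 if k ≥ 1, while θ = 1/3 and ρ = 0 if k = 0. One type of measure is thus studied, and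
raising k by one doubles the coordinate.

An optimal set is compared with sets in which a few points are moved, mostly to means: 8/7 of T,
24/7 of B, 4/7 and 12/7 of the two halves of T. The errors of the new sets follow from the first two
moments. Lower bounds for the old error rest on the centroid condition: the integral of y - a over
the cell of a vanishes, so λ (y - a) may be added on that cell at no cost. Since (y - a)² + λ (y -
a) = (y - a)(y - a + λ), this transfers error between T, B and ρ, and a suitable λ leaves an
integrand bounded below by an explicit quadratic.

Two points with y ≤ 2 force a point in [3, 4] (`IsMinimizer.exists_mem_block`). At the preceding
level this gives a point in [6, 8], so ρ is served from the right of the block and decouples from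
the rest. Then (2, 3) contains no point (`IsMinimizer.not_mem_gap`), and the next union of basic
intervals contains one (`IsMinimizer.exists_mem_tail`). The Voronoi claims need a little more: a
point in (1, 2] (`IsMinimizer.exists_mem_upper_tail`) is nearer to all of [0, 2] than any block
point is, and a point in [3, 4) (`IsMinimizer.exists_mem_block_lt`) is nearer to all of [3, 4] than
any tail point is. -/

instance : IsProbabilityMeasure P := isSelfSimilar_P.1

/-- The law of `1 - X` when `X` has law `P`. -/
noncomputable def reflLaw : Measure ℝ := P.map fun x => 1 - x

/-- The law of `1 - X` conditioned on a tail of basic intervals, rescaled to `[0, 2]`. -/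
noncomputable def tailLaw : Measure ℝ :=
  Measure.sum fun i : ℕ => ENNReal.ofReal (1 / 2 ^ (i + 1)) •
    reflLaw.map fun y => (3 + y) / 2 ^ (i + 1)

/-- The law of `4 - X` when `X` has law `P`. -/
noncomputable def blockLaw : Measure ℝ := reflLaw.map fun y => 3 + y

instance : IsProbabilityMeasure reflLaw :=
  Measure.isProbabilityMeasure_map (by fun_prop)

instance : IsProbabilityMeasure blockLaw :=
  Measure.isProbabilityMeasure_map (by fun_prop)

instance : IsProbabilityMeasure tailLaw := by
  refine ⟨?_⟩
  have h : ∀ i : ℕ, (reflLaw.map fun y => (3 + y) / 2 ^ (i + 1)) Set.univ = 1 := fun i => by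
    rw [Measure.map_apply (by fun_prop) MeasurableSet.univ]; simp
  have hs := hasSum_geometric_two' 1
  have e : (fun n : ℕ => (1 : ℝ) / 2 / 2 ^ n) = fun n : ℕ => 1 / 2 ^ (n + 1) := by
    funext n; rw [pow_succ]; field_simp
  rw [e] at hs
  simp only [tailLaw, Measure.sum_apply _ MeasurableSet.univ, Measure.smul_apply, h, smul_eq_mul,
    mul_one]
  rw [← ENNReal.ofReal_tsum_of_nonneg (fun j => by positivity) hs.summable, hs.tsum_eq,
    ENNReal.ofReal_one]

lemma sum_eq_zero_add_sum_succ (m : ℕ → Measure ℝ) :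
    Measure.sum m = m 0 + Measure.sum fun i => m (i + 1) := by
  ext s hs
  rw [Measure.add_apply, Measure.sum_apply _ hs, Measure.sum_apply _ hs,
    tsum_eq_zero_add' ENNReal.summable]

lemma reflLaw_eq_sum : reflLaw = Measure.sum fun j : ℕ => ENNReal.ofReal (prob (j + 1)) •
    reflLaw.map fun y => (3 + y) / 2 ^ (j + 2) := by
  conv_lhs => rw [reflLaw, isSelfSimilar_P.2, Measure.map_sum (by fun_prop)]
  congr 1
  funext j
  rw [Measure.map_smul, Measure.map_map (by fun_prop) (measurable_S _), reflLaw,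
    Measure.map_map (by fun_prop) (by fun_prop)]
  congr 2
  funext x
  simp only [Function.comp, S, Nat.add_sub_cancel]
  field_simp
  ring

/-- The weights are geometric, so removing the first block, of mass 1/2, leaves a half-size copy of
the whole tail. Together with `reflLaw_eq` this closes the system for the moments and lets any
integral be refined by one generation. -/
lemma tailLaw_eq : tailLaw = ENNReal.ofReal (1 / 2) • reflLaw.map (fun y => (3 + y) / 2) +
    ENNReal.ofReal (1 / 2) • tailLaw.map fun t => t / 2 := by
  conv_lhs => rw [tailLaw, sum_eq_zero_add_sum_succ]
  congr 1
  · simp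
  · rw [tailLaw, Measure.map_sum (by fun_prop)]
    ext s hs
    simp only [Measure.smul_apply, Measure.sum_apply _ hs, smul_eq_mul, Measure.map_smul]
    rw [← ENNReal.tsum_mul_left]
    refine tsum_congr fun i => ?_
    rw [Measure.map_map (by fun_prop) (by fun_prop), ← mul_assoc,
      ← ENNReal.ofReal_mul (by norm_num)]
    congr 2
    · rw [pow_succ _ (i + 1)]; field_simp
    · congr 1; funext x; simp only [Function.comp]; rw [pow_succ _ (i + 1)]; field_simp

lemma reflLaw_eq : reflLaw = ENNReal.ofReal (1 / 4) • reflLaw.map (fun y => (3 + y) / 4) +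
    ENNReal.ofReal (3 / 4) • tailLaw.map fun t => t / 4 := by
  conv_lhs => rw [reflLaw_eq_sum, sum_eq_zero_add_sum_succ]
  congr 1
  · norm_num [prob]
  · rw [tailLaw, Measure.map_sum (by fun_prop)]
    ext s hs
    simp only [Measure.smul_apply, Measure.sum_apply _ hs, smul_eq_mul, Measure.map_smul]
    rw [← ENNReal.tsum_mul_left]
    refine tsum_congr fun i => ?_
    rw [Measure.map_map (by fun_prop) (by fun_prop), ← mul_assoc,
      ← ENNReal.ofReal_mul (by norm_num)]
    congr 2
    · simp only [prob, Nat.add_eq_right, Nat.succ_ne_zero, if_false]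
      field_simp
      ring
    · congr 1; funext x; simp only [Function.comp]; field_simp; ring

/-- Every branch maps [0, 1] into itself and contracts by a factor of at least 4, so an image point
farther than r from [0, 1] comes from a point farther than 4r. Iteration shows that the law is
carried by [0, 1]. -/
lemma reflLaw_far_le (r : ℝ) (hr : 0 ≤ r) :
    reflLaw {y | y < -r ∨ 1 + r < y} ≤ reflLaw {y | y < -(4 * r) ∨ 1 + 4 * r < y} := by
  have hm : ∀ r : ℝ, MeasurableSet {y : ℝ | y < -r ∨ 1 + r < y} := fun r =>
    (measurableSet_lt measurable_id measurable_const).union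
      (measurableSet_lt measurable_const measurable_id)
  conv_lhs => rw [reflLaw_eq_sum]
  rw [Measure.sum_apply _ (hm r)]
  calc _ ≤ ∑' j : ℕ, ENNReal.ofReal (prob (j + 1)) *
        reflLaw {y | y < -(4 * r) ∨ 1 + 4 * r < y} := by
        refine ENNReal.tsum_le_tsum fun j => ?_
        rw [Measure.smul_apply, smul_eq_mul, Measure.map_apply (by fun_prop) (hm r)]
        refine mul_le_mul_right (measure_mono fun y hy => ?_) _
        have h4 : (4 : ℝ) ≤ 2 ^ (j + 2) := by
          have : (1 : ℝ) ≤ 2 ^ j := one_le_pow₀ (by norm_num)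
          rw [pow_add]; linarith
        have hp : (0 : ℝ) < 2 ^ (j + 2) := by positivity
        simp only [Set.mem_preimage, Set.mem_ofPred_eq] at hy ⊢
        rw [div_lt_iff₀ hp, lt_div_iff₀ hp] at hy
        rcases hy with hy | hy
        · left; nlinarith
        · right; nlinarith
    _ = _ := by rw [ENNReal.tsum_mul_right, tsum_ofReal_prob, one_mul]

lemma reflLaw_far_eq_zero (r : ℝ) (hr : 0 < r) : reflLaw {y | y < -r ∨ 1 + r < y} = 0 := by
  have h1 : ∀ n : ℕ, reflLaw {y | y < -r ∨ 1 + r < y} ≤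
      reflLaw {y | y < -(4 ^ n * r) ∨ 1 + 4 ^ n * r < y} := by
    intro n
    induction n with
    | zero => simp
    | succ n ih =>
      refine ih.trans ((reflLaw_far_le _ (by positivity)).trans_eq ?_)
      rw [← mul_assoc, ← pow_succ']
  have h2 : Filter.Tendsto
      (fun n : ℕ => reflLaw {y | y < -(4 ^ n * r) ∨ 1 + 4 ^ n * r < y}) Filter.atTop
      (nhds (reflLaw (⋂ n : ℕ, {y | y < -(4 ^ n * r) ∨ 1 + 4 ^ n * r < y}))) := by
    refine tendsto_measure_iInter_atTop (fun n => MeasurableSet.nullMeasurableSet ?_) ?_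
      ⟨0, measure_ne_top _ _⟩
    · exact (measurableSet_lt measurable_id measurable_const).union
        (measurableSet_lt measurable_const measurable_id)
    · intro m n hmn y hy
      have : (4 : ℝ) ^ m * r ≤ 4 ^ n * r := by gcongr; norm_num
      simp only [Set.mem_ofPred_eq] at hy ⊢
      rcases hy with hy | hy
      · left; linarith
      · right; linarith
  have h3 : (⋂ n : ℕ, {y : ℝ | y < -(4 ^ n * r) ∨ 1 + 4 ^ n * r < y}) = ∅ := by
    refine Set.eq_empty_iff_forall_notMem.2 fun y hy => ?_
    obtain ⟨n, hn⟩ := pow_unbounded_of_one_lt (|y| / r) (by norm_num : (1 : ℝ) < 4)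
    rw [div_lt_iff₀ hr] at hn
    have := Set.mem_iInter.1 hy n
    simp only [Set.mem_ofPred_eq] at this
    rcases this with h | h
    · linarith [neg_abs_le y]
    · linarith [le_abs_self y]
  rw [h3, measure_empty] at h2
  exact le_antisymm (ge_of_tendsto' h2 h1) zero_le

lemma ae_reflLaw : ∀ᵐ y ∂reflLaw, 0 ≤ y ∧ y ≤ 1 := by
  have h : ∀ n : ℕ, ∀ᵐ y ∂reflLaw, ¬(y < -(1 / (n + 1 : ℝ)) ∨ 1 + 1 / (n + 1 : ℝ) < y) := fun n =>
    measure_eq_zero_iff_ae_notMem.1 (reflLaw_far_eq_zero _ (by positivity))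
  filter_upwards [ae_all_iff.2 h] with y hy
  constructor
  · by_contra! h0
    obtain ⟨n, hn⟩ := exists_nat_one_div_lt (neg_pos.2 h0)
    exact hy n (Or.inl (by linarith))
  · by_contra! h0
    obtain ⟨n, hn⟩ := exists_nat_one_div_lt (sub_pos.2 h0)
    exact hy n (Or.inr (by linarith))

lemma ae_blockLaw : ∀ᵐ y ∂blockLaw, 3 ≤ y ∧ y ≤ 4 := by
  rw [blockLaw, ae_map_iff (by fun_prop) measurableSet_Icc]
  filter_upwards [ae_reflLaw] with y hy
  constructor <;> linarith [hy.1, hy.2]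

lemma ae_tailLaw : ∀ᵐ y ∂tailLaw, 0 ≤ y ∧ y ≤ 2 := by
  rw [tailLaw, Measure.ae_sum_iff]
  intro i
  refine Measure.ae_smul_measure ?_ _
  rw [ae_map_iff (by fun_prop) measurableSet_Icc]
  filter_upwards [ae_reflLaw] with y hy
  have : (1 : ℝ) ≤ 2 ^ i := one_le_pow₀ (by norm_num)
  have := hy.1
  refine ⟨by positivity, ?_⟩
  rw [div_le_iff₀ (by positivity), pow_succ]
  linarith [hy.2]

/-! ### Integration against these laws -/

/-- A finite measure carried by a bounded interval. -/
def IsBounded (μ : Measure ℝ) : Prop :=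
  IsFiniteMeasure μ ∧ ∃ a b : ℝ, ∀ᵐ y ∂μ, a ≤ y ∧ y ≤ b

lemma isBounded_reflLaw : IsBounded reflLaw := ⟨inferInstance, 0, 1, ae_reflLaw⟩
lemma isBounded_blockLaw : IsBounded blockLaw := ⟨inferInstance, 3, 4, ae_blockLaw⟩
lemma isBounded_tailLaw : IsBounded tailLaw := ⟨inferInstance, 0, 2, ae_tailLaw⟩

lemma IsBounded.integrable {μ : Measure ℝ} (h : IsBounded μ) {f : ℝ → ℝ} (hf : Continuous f) :
    Integrable f μ := by
  obtain ⟨h1, a, b, h2⟩ := h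
  obtain ⟨C, hC⟩ := isCompact_Icc.exists_bound_of_continuousOn (hf.continuousOn (s := Set.Icc a b))
  exact Integrable.of_bound hf.aestronglyMeasurable C (h2.mono fun y hy => hC y hy)

lemma integral_ofReal_smul (μ : Measure ℝ) (f : ℝ → ℝ) {c : ℝ} (hc : 0 ≤ c) :
    ∫ y, f y ∂(ENNReal.ofReal c • μ) = c * ∫ y, f y ∂μ := by
  rw [integral_smul_measure, ENNReal.toReal_ofReal hc, smul_eq_mul]

lemma tailLaw_integrable {f : ℝ → ℝ} (hf : Integrable f tailLaw) :
    Integrable (fun z => f ((3 + z) / 2)) reflLaw ∧ Integrable (fun t => f (t / 2)) tailLaw := by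
  rw [tailLaw_eq, integrable_add_measure, integrable_smul_measure (by simp) (by simp),
    integrable_smul_measure (by simp) (by simp)] at hf
  exact ⟨hf.1.comp_measurable (by fun_prop), hf.2.comp_measurable (by fun_prop)⟩

lemma reflLaw_integrable {f : ℝ → ℝ} (hf : Integrable f reflLaw) :
    Integrable (fun z => f ((3 + z) / 4)) reflLaw ∧ Integrable (fun t => f (t / 4)) tailLaw := by
  rw [reflLaw_eq, integrable_add_measure, integrable_smul_measure (by simp) (by simp),
    integrable_smul_measure (by simp) (by simp)] at hf
  exact ⟨hf.1.comp_measurable (by fun_prop), hf.2.comp_measurable (by fun_prop)⟩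

lemma integral_tailLaw {f : ℝ → ℝ} (hf : Integrable f tailLaw) :
    ∫ y, f y ∂tailLaw =
      1 / 2 * ∫ z, f ((3 + z) / 2) ∂reflLaw + 1 / 2 * ∫ t, f (t / 2) ∂tailLaw := by
  have hf' := hf
  rw [tailLaw_eq, integrable_add_measure] at hf'
  conv_lhs => rw [tailLaw_eq]
  rw [integral_add_measure hf'.1 hf'.2, integral_ofReal_smul _ _ (by norm_num),
    integral_ofReal_smul _ _ (by norm_num)]
  rw [integrable_smul_measure (by simp) (by simp), integrable_smul_measure (by simp) (by simp)]
    at hf'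
  rw [integral_map (by fun_prop) hf'.1.1, integral_map (by fun_prop) hf'.2.1]

lemma integral_reflLaw {f : ℝ → ℝ} (hf : Integrable f reflLaw) :
    ∫ y, f y ∂reflLaw =
      1 / 4 * ∫ z, f ((3 + z) / 4) ∂reflLaw + 3 / 4 * ∫ t, f (t / 4) ∂tailLaw := by
  have hf' := hf
  rw [reflLaw_eq, integrable_add_measure] at hf'
  conv_lhs => rw [reflLaw_eq]
  rw [integral_add_measure hf'.1 hf'.2, integral_ofReal_smul _ _ (by norm_num),
    integral_ofReal_smul _ _ (by norm_num)]
  rw [integrable_smul_measure (by simp) (by simp), integrable_smul_measure (by simp) (by simp)]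
    at hf'
  rw [integral_map (by fun_prop) hf'.1.1, integral_map (by fun_prop) hf'.2.1]

lemma blockLaw_integrable {f : ℝ → ℝ} (hf : Integrable f blockLaw) :
    Integrable (fun z => f (3 + z)) reflLaw :=
  Integrable.comp_measurable hf (by fun_prop)

lemma integral_blockLaw {f : ℝ → ℝ} (hf : Integrable f blockLaw) :
    ∫ y, f y ∂blockLaw = ∫ z, f (3 + z) ∂reflLaw :=
  integral_map (by fun_prop) hf.1

/-! ### Moments, and comparison of integrands with quadratic polynomials -/

lemma integral_quadratic {μ : Measure ℝ} [IsProbabilityMeasure μ] (h : IsBounded μ)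
    (a b c : ℝ) : ∫ y, (a + b * y + c * y ^ 2) ∂μ =
      a + b * (∫ y, y ∂μ) + c * ∫ y, y ^ 2 ∂μ := by
  have h1 : Integrable (fun y : ℝ => b * y) μ := h.integrable (by fun_prop)
  have h2 : Integrable (fun y : ℝ => c * y ^ 2) μ := h.integrable (by fun_prop)
  have h3 : Integrable (fun y : ℝ => a + b * y) μ := h.integrable (by fun_prop)
  rw [integral_add h3 h2, integral_add (integrable_const _) h1, integral_const,
    integral_const_mul, integral_const_mul]
  simp

/-- Self-similarity gives a linear system for the two means and then another for the two second
moments. The resulting variances are 288/3577 for the block and 1376/3577 for the tail. -/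
lemma moments : (∫ y, y ∂reflLaw = 3 / 7 ∧ ∫ y, y ∂tailLaw = 8 / 7) ∧
    ∫ y, y ^ 2 ∂reflLaw = 135 / 511 ∧ ∫ y, y ^ 2 ∂tailLaw = 864 / 511 := by
  have a1 := integral_reflLaw (isBounded_reflLaw.integrable (f := fun y => y) (by fun_prop))
  have a2 := integral_tailLaw (isBounded_tailLaw.integrable (f := fun y => y) (by fun_prop))
  have b1 := integral_reflLaw (isBounded_reflLaw.integrable (f := fun y => y ^ 2) (by fun_prop))
  have b2 := integral_tailLaw (isBounded_tailLaw.integrable (f := fun y => y ^ 2) (by fun_prop))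
  have q := fun a b c => integral_quadratic isBounded_reflLaw a b c
  have t := fun a b c => integral_quadratic isBounded_tailLaw a b c
  have e1 : ∫ z, (3 + z) / 4 ∂reflLaw = 3 / 4 + 1 / 4 * ∫ y, y ∂reflLaw := by
    rw [← add_zero (_ + _), ← zero_mul (∫ y, y ^ 2 ∂reflLaw), ← q]; congr 1; funext z; ring
  have e2 : ∫ z, (3 + z) / 2 ∂reflLaw = 3 / 2 + 1 / 2 * ∫ y, y ∂reflLaw := by
    rw [← add_zero (_ + _), ← zero_mul (∫ y, y ^ 2 ∂reflLaw), ← q]; congr 1; funext z; ring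
  have e3 : ∫ z, ((3 + z) / 4) ^ 2 ∂reflLaw =
      9 / 16 + 3 / 8 * ∫ y, y ∂reflLaw + 1 / 16 * ∫ y, y ^ 2 ∂reflLaw := by
    rw [← q]; congr 1; funext z; ring
  have e4 : ∫ z, ((3 + z) / 2) ^ 2 ∂reflLaw =
      9 / 4 + 3 / 2 * ∫ y, y ∂reflLaw + 1 / 4 * ∫ y, y ^ 2 ∂reflLaw := by
    rw [← q]; congr 1; funext z; ring
  have f3 : ∫ z, (z / 4) ^ 2 ∂tailLaw = 1 / 16 * ∫ y, y ^ 2 ∂tailLaw := by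
    rw [← integral_const_mul]; congr 1; funext z; ring
  have f4 : ∫ z, (z / 2) ^ 2 ∂tailLaw = 1 / 4 * ∫ y, y ^ 2 ∂tailLaw := by
    rw [← integral_const_mul]; congr 1; funext z; ring
  rw [e1, integral_div] at a1
  rw [e2, integral_div] at a2
  rw [e3, f3] at b1
  rw [e4, f4] at b2
  have m1 : ∫ y, y ∂reflLaw = 3 / 7 := by linarith
  have m2 : ∫ y, y ∂tailLaw = 8 / 7 := by linarith
  rw [m1] at b1 b2
  exact ⟨⟨m1, m2⟩, by linarith, by linarith⟩

lemma integral_reflLaw_quadratic (a b c : ℝ) :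
    ∫ y, (a + b * y + c * y ^ 2) ∂reflLaw = a + b * (3 / 7) + c * (135 / 511) := by
  rw [integral_quadratic isBounded_reflLaw, moments.1.1, moments.2.1]

lemma integral_tailLaw_quadratic (a b c : ℝ) :
    ∫ y, (a + b * y + c * y ^ 2) ∂tailLaw = a + b * (8 / 7) + c * (864 / 511) := by
  rw [integral_quadratic isBounded_tailLaw, moments.1.2, moments.2.2]

lemma le_integral_reflLaw {f : ℝ → ℝ} (hf : Integrable f reflLaw) (a b c : ℝ)
    (h : ∀ z, 0 ≤ z → z ≤ 1 → a + b * z + c * z ^ 2 ≤ f z) :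
    a + b * (3 / 7) + c * (135 / 511) ≤ ∫ z, f z ∂reflLaw := by
  rw [← integral_reflLaw_quadratic]
  exact integral_mono_ae (isBounded_reflLaw.integrable (by fun_prop)) hf
    (ae_reflLaw.mono fun z hz => h z hz.1 hz.2)

lemma integral_reflLaw_le {f : ℝ → ℝ} (hf : Integrable f reflLaw) (a b c : ℝ)
    (h : ∀ z, 0 ≤ z → z ≤ 1 → f z ≤ a + b * z + c * z ^ 2) :
    ∫ z, f z ∂reflLaw ≤ a + b * (3 / 7) + c * (135 / 511) := by
  rw [← integral_reflLaw_quadratic]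
  exact integral_mono_ae hf (isBounded_reflLaw.integrable (by fun_prop))
    (ae_reflLaw.mono fun z hz => h z hz.1 hz.2)

lemma le_integral_tailLaw {f : ℝ → ℝ} (hf : Integrable f tailLaw) (a b c : ℝ)
    (h : ∀ z, 0 ≤ z → z ≤ 2 → a + b * z + c * z ^ 2 ≤ f z) :
    a + b * (8 / 7) + c * (864 / 511) ≤ ∫ z, f z ∂tailLaw := by
  rw [← integral_tailLaw_quadratic]
  exact integral_mono_ae (isBounded_tailLaw.integrable (by fun_prop)) hf
    (ae_tailLaw.mono fun z hz => h z hz.1 hz.2)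

lemma integral_tailLaw_le {f : ℝ → ℝ} (hf : Integrable f tailLaw) (a b c : ℝ)
    (h : ∀ z, 0 ≤ z → z ≤ 2 → f z ≤ a + b * z + c * z ^ 2) :
    ∫ z, f z ∂tailLaw ≤ a + b * (8 / 7) + c * (864 / 511) := by
  rw [← integral_tailLaw_quadratic]
  exact integral_mono_ae hf (isBounded_tailLaw.integrable (by fun_prop))
    (ae_tailLaw.mono fun z hz => h z hz.1 hz.2)

/-- Lower bound for an integral over the tail from bounds on its first block and on the rest. -/
lemma le_integral_tailLaw_split {f : ℝ → ℝ} (hf : Integrable f tailLaw) (a b c a' b' c' : ℝ)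
    (h : ∀ z, 0 ≤ z → z ≤ 1 → a + b * z + c * z ^ 2 ≤ f ((3 + z) / 2))
    (h' : ∀ z, 0 ≤ z → z ≤ 2 → a' + b' * z + c' * z ^ 2 ≤ f (z / 2)) :
    1 / 2 * (a + b * (3 / 7) + c * (135 / 511)) +
      1 / 2 * (a' + b' * (8 / 7) + c' * (864 / 511)) ≤ ∫ z, f z ∂tailLaw := by
  rw [integral_tailLaw hf]
  have h1 := le_integral_reflLaw (tailLaw_integrable hf).1 a b c h
  have h2 := le_integral_tailLaw (tailLaw_integrable hf).2 a' b' c' h'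
  linarith

/-- Upper bound for an integral over the tail from bounds on its first block and on the rest. -/
lemma integral_tailLaw_split_le {f : ℝ → ℝ} (hf : Integrable f tailLaw) (a b c a' b' c' : ℝ)
    (h : ∀ z, 0 ≤ z → z ≤ 1 → f ((3 + z) / 2) ≤ a + b * z + c * z ^ 2)
    (h' : ∀ z, 0 ≤ z → z ≤ 2 → f (z / 2) ≤ a' + b' * z + c' * z ^ 2) :
    ∫ z, f z ∂tailLaw ≤ 1 / 2 * (a + b * (3 / 7) + c * (135 / 511)) +
      1 / 2 * (a' + b' * (8 / 7) + c' * (864 / 511)) := by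
  rw [integral_tailLaw hf]
  have h1 := integral_reflLaw_le (tailLaw_integrable hf).1 a b c h
  have h2 := integral_tailLaw_le (tailLaw_integrable hf).2 a' b' c' h'
  linarith

lemma le_integral_blockLaw {f : ℝ → ℝ} (hf : Integrable f blockLaw) (a b c : ℝ)
    (h : ∀ z, 0 ≤ z → z ≤ 1 → a + b * z + c * z ^ 2 ≤ f (3 + z)) :
    a + b * (3 / 7) + c * (135 / 511) ≤ ∫ z, f z ∂blockLaw := by
  rw [integral_blockLaw hf]
  exact le_integral_reflLaw (blockLaw_integrable hf) a b c h

lemma integral_blockLaw_le {f : ℝ → ℝ} (hf : Integrable f blockLaw) (a b c : ℝ)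
    (h : ∀ z, 0 ≤ z → z ≤ 1 → f (3 + z) ≤ a + b * z + c * z ^ 2) :
    ∫ z, f z ∂blockLaw ≤ a + b * (3 / 7) + c * (135 / 511) := by
  rw [integral_blockLaw hf]
  exact integral_reflLaw_le (blockLaw_integrable hf) a b c h

/-- Upper bound for an integral over a block from bounds on its three outermost parts. -/
lemma integral_blockLaw_split_le {f : ℝ → ℝ} (hf : Integrable f blockLaw)
    (a b c a' b' c' a'' b'' c'' : ℝ)
    (h : ∀ z, 0 ≤ z → z ≤ 1 → f (3 + (3 + z) / 4) ≤ a + b * z + c * z ^ 2)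
    (h' : ∀ z, 0 ≤ z → z ≤ 1 → f (3 + (3 + z) / 8) ≤ a' + b' * z + c' * z ^ 2)
    (h'' : ∀ z, 0 ≤ z → z ≤ 2 → f (3 + z / 8) ≤ a'' + b'' * z + c'' * z ^ 2) :
    ∫ z, f z ∂blockLaw ≤ 1 / 4 * (a + b * (3 / 7) + c * (135 / 511)) +
      3 / 8 * (a' + b' * (3 / 7) + c' * (135 / 511)) +
      3 / 8 * (a'' + b'' * (8 / 7) + c'' * (864 / 511)) := by
  have i1 := reflLaw_integrable (blockLaw_integrable hf)
  rw [integral_blockLaw hf, integral_reflLaw (blockLaw_integrable hf)]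
  have h1 := integral_reflLaw_le i1.1 a b c h
  have h2 := integral_tailLaw_split_le i1.2 a' b' c' a'' b'' c''
    (fun z h0 h1 => by convert! h' z h0 h1 using 3; ring)
    (fun z h0 h1 => by convert! h'' z h0 h1 using 3; ring)
  linarith

/-! ### Optimal sets of a bounded measure on the line -/

/-- The squared distance to a finite set. -/
noncomputable def sqDist (α : Finset ℝ) (y : ℝ) : ℝ := Metric.infDist y (α : Set ℝ) ^ 2

/-- The points whose nearest point in `α` is `a`, ties being resolved to the right. -/
def cell (α : Finset ℝ) (a : ℝ) : Set ℝ :=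
  {y | ∀ b ∈ α, |y - a| ≤ |y - b| ∧ (a < b → |y - a| < |y - b|)}

/-- `α` minimizes the mean squared distance among the sets with at most as many points. -/
def IsMinimizer (μ : Measure ℝ) (α : Finset ℝ) : Prop :=
  α.Nonempty ∧ ∀ β : Finset ℝ, β.Nonempty → β.card ≤ α.card →
    ∫ y, sqDist α y ∂μ ≤ ∫ y, sqDist β y ∂μ

/-- Functions that are integrable for every bounded measure. -/
def IsTame (h : ℝ → ℝ) : Prop := ∀ μ : Measure ℝ, IsBounded μ → Integrable h μ

lemma continuous_sqDist (α : Finset ℝ) : Continuous (sqDist α) :=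
  (Metric.continuous_infDist_pt _).pow 2

lemma measurableSet_cell (α : Finset ℝ) (a : ℝ) : MeasurableSet (cell α a) := by
  have : cell α a = ⋂ b ∈ α, {y : ℝ | |y - a| ≤ |y - b|} ∩
      {y : ℝ | a < b → |y - a| < |y - b|} := by
    ext y; simp only [cell, Set.mem_ofPred_eq, Set.mem_iInter, Set.mem_inter_iff]
  rw [this]
  refine Finset.measurableSet_biInter _ fun b _ => MeasurableSet.inter ?_ ?_
  · exact measurableSet_le (by fun_prop) (by fun_prop)
  · by_cases h : a < b
    · simp only [h, forall_const]
      exact measurableSet_lt (by fun_prop) (by fun_prop)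
    · simp [h]

lemma Continuous.isTame {h : ℝ → ℝ} (hh : Continuous h) : IsTame h :=
  fun _ hμ => hμ.integrable hh

lemma isTame_sqDist (α : Finset ℝ) : IsTame (sqDist α) := Continuous.isTame (continuous_sqDist α)

lemma IsTame.indicator {h : ℝ → ℝ} (hh : IsTame h) (α : Finset ℝ) (a : ℝ) :
    IsTame ((cell α a).indicator h) :=
  fun μ hμ => (hh μ hμ).indicator (measurableSet_cell α a)

lemma IsTame.add {h g : ℝ → ℝ} (hh : IsTame h) (hg : IsTame g) : IsTame fun y => h y + g y :=
  fun μ hμ => (hh μ hμ).add (hg μ hμ)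

lemma IsTame.sub {h g : ℝ → ℝ} (hh : IsTame h) (hg : IsTame g) : IsTame fun y => h y - g y :=
  fun μ hμ => (hh μ hμ).sub (hg μ hμ)

lemma IsTame.const_mul {h : ℝ → ℝ} (c : ℝ) (hh : IsTame h) : IsTame fun y => c * h y :=
  fun μ hμ => (hh μ hμ).const_mul c

lemma sqDist_le {β : Finset ℝ} {b : ℝ} (hb : b ∈ β) (y : ℝ) : sqDist β y ≤ (y - b) ^ 2 := by
  have h := Metric.infDist_le_dist_of_mem (x := y) (Finset.mem_coe.2 hb)
  rw [sqDist, ← sq_abs (y - b), ← Real.dist_eq]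
  exact pow_le_pow_left₀ Metric.infDist_nonneg h 2

lemma exists_sqDist_eq {α : Finset ℝ} (hα : α.Nonempty) (y : ℝ) :
    ∃ a ∈ α, sqDist α y = (y - a) ^ 2 := by
  obtain ⟨a, ha, h⟩ := α.finite_toSet.isCompact.exists_infDist_eq_dist (Finset.coe_nonempty.2 hα) y
  exact ⟨a, ha, by rw [sqDist, h, Real.dist_eq, sq_abs]⟩

lemma le_sqDist {α : Finset ℝ} (hα : α.Nonempty) {c y : ℝ} (h : ∀ a ∈ α, c ≤ (y - a) ^ 2) :
    c ≤ sqDist α y := by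
  obtain ⟨a, ha, e⟩ := exists_sqDist_eq hα y
  exact e ▸ h a ha

lemma sqDist_nonneg (α : Finset ℝ) (y : ℝ) : 0 ≤ sqDist α y := sq_nonneg _

lemma sqDist_eq_of_mem_cell {α : Finset ℝ} {a y : ℝ} (ha : a ∈ α) (hy : y ∈ cell α a) :
    sqDist α y = (y - a) ^ 2 :=
  le_antisymm (sqDist_le ha y) (le_sqDist ⟨a, ha⟩ fun b hb => sq_le_sq.2 (hy b hb).1)

lemma exists_mem_cell {α : Finset ℝ} (hα : α.Nonempty) (y : ℝ) : ∃ a ∈ α, y ∈ cell α a := by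
  classical
  obtain ⟨c, hc, hmin⟩ := α.exists_min_image (fun b => |y - b|) hα
  have hne : (α.filter fun a => |y - a| = |y - c|).Nonempty :=
    ⟨c, Finset.mem_filter.2 ⟨hc, rfl⟩⟩
  obtain ⟨a, ha, hmax⟩ := Finset.exists_max_image _ id hne
  rw [Finset.mem_filter] at ha
  refine ⟨a, ha.1, fun b hb => ⟨ha.2 ▸ hmin b hb, fun hab => ?_⟩⟩
  rw [ha.2]
  refine lt_of_le_of_ne (hmin b hb) fun h => ?_
  exact absurd (hmax b (Finset.mem_filter.2 ⟨hb, h.symm⟩)) (not_le.2 hab)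

lemma cell_unique {α : Finset ℝ} {a b y : ℝ} (ha : a ∈ α) (hb : b ∈ α) (hya : y ∈ cell α a)
    (hyb : y ∈ cell α b) : a = b := by
  rcases lt_trichotomy a b with h | h | h
  · exact absurd ((hya b hb).2 h) (not_lt.2 (hyb a ha).1)
  · exact h
  · exact absurd ((hyb a ha).2 h) (not_lt.2 (hya b hb).1)

/-! ### Variational conditions satisfied by a minimizer -/

section
variable {μ : Measure ℝ} {α : Finset ℝ}

/-- Moving a by ε while keeping the assignment of points to cells changes the error by -2εI + ε²m,
an upper bound for the true change. Minimality makes this nonnegative for every ε, hence I = 0. -/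
lemma IsMinimizer.integral_cell_eq_zero (hμ : IsBounded μ) (h : IsMinimizer μ α) {a : ℝ}
    (ha : a ∈ α) : ∫ y, (cell α a).indicator (fun y => y - a) y ∂μ = 0 := by
  classical
  have := hμ.1
  set I := ∫ y, (cell α a).indicator (fun y => y - a) y ∂μ with hI
  set m := ∫ y, (cell α a).indicator (fun _ => (1 : ℝ)) y ∂μ with hm
  have hm0 : 0 ≤ m := integral_nonneg fun y => Set.indicator_nonneg (fun _ _ => zero_le_one) y
  have t1 : IsTame ((cell α a).indicator (fun y => y - a)) :=
    (Continuous.isTame (by fun_prop)).indicator α a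
  have t2 : IsTame ((cell α a).indicator (fun _ => (1 : ℝ))) :=
    (Continuous.isTame (by fun_prop)).indicator α a
  have key : ∀ ε : ℝ, 0 ≤ -2 * ε * I + ε ^ 2 * m := by
    intro ε
    have h1 := h.2 (insert (a + ε) (α.erase a)) ⟨_, Finset.mem_insert_self _ _⟩ (by
      refine (Finset.card_insert_le _ _).trans ?_
      rw [Finset.card_erase_of_mem ha]
      have := Finset.card_pos.2 h.1
      omega)
    have h2 : ∫ y, sqDist (insert (a + ε) (α.erase a)) y ∂μ ≤ ∫ y, (sqDist α y +
        (-2 * ε * (cell α a).indicator (fun y => y - a) y +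
          ε ^ 2 * (cell α a).indicator (fun _ => (1 : ℝ)) y)) ∂μ := by
      refine integral_mono (isTame_sqDist _ _ hμ)
        ((isTame_sqDist _).add ((t1.const_mul _).add (t2.const_mul _)) μ hμ) fun y => ?_
      obtain ⟨b, hb, hy⟩ := exists_mem_cell h.1 y
      change _ ≤ sqDist α y + _
      rw [sqDist_eq_of_mem_cell hb hy]
      by_cases hab : b = a
      · subst hab
        rw [Set.indicator_of_mem hy, Set.indicator_of_mem hy]
        refine (sqDist_le (Finset.mem_insert_self _ _) y).trans (le_of_eq ?_)
        ring
      · have : y ∉ cell α a := fun h => hab (cell_unique hb ha hy h)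
        rw [Set.indicator_of_notMem this, Set.indicator_of_notMem this]
        refine (sqDist_le (Finset.mem_insert_of_mem (Finset.mem_erase.2 ⟨hab, hb⟩)) y).trans
          (le_of_eq ?_)
        ring
    rw [integral_add (isTame_sqDist _ _ hμ) ((t1.const_mul _).add (t2.const_mul _) μ hμ),
      integral_add (t1.const_mul _ μ hμ) (t2.const_mul _ μ hμ), integral_const_mul, integral_const_mul] at h2
    linarith
  -- The denominator m + 1 instead of m covers a cell of mass zero.
  have h1 := key (I / (m + 1))
  have h2 : -2 * (I / (m + 1)) * I + (I / (m + 1)) ^ 2 * m =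
      -(I ^ 2 * (m + 2)) / (m + 1) ^ 2 := by
    field_simp; ring
  rw [h2, le_div_iff₀ (by positivity)] at h1
  have h3 : I ^ 2 ≤ 0 := by nlinarith [sq_nonneg I]
  exact pow_eq_zero_iff (two_ne_zero) |>.1 (le_antisymm h3 (sq_nonneg I))

/-- A point with a null cell can be moved to any t without loss, so minimality gives `sqDist α y ≤
(y - t) ^ 2` almost everywhere. Using all rational t at once, the distance to α vanishes almost
everywhere and the measure is carried by a finite set. -/
lemma IsMinimizer.measure_cell_pos (hμ : IsBounded μ) (h : IsMinimizer μ α)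
    (hfin : ∀ s : Finset ℝ, ¬ ∀ᵐ y ∂μ, y ∈ s) {a : ℝ} (ha : a ∈ α) : μ (cell α a) ≠ 0 := by
  classical
  intro h0
  have h0' : ∀ᵐ y ∂μ, y ∉ cell α a := measure_eq_zero_iff_ae_notMem.1 h0
  have step : ∀ t : ℝ, ∀ᵐ y ∂μ, sqDist α y ≤ (y - t) ^ 2 := by
    intro t
    have h1 := h.2 (insert t (α.erase a)) ⟨_, Finset.mem_insert_self _ _⟩ (by
      refine (Finset.card_insert_le _ _).trans ?_
      rw [Finset.card_erase_of_mem ha]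
      have := Finset.card_pos.2 h.1
      omega)
    have tm : Continuous fun y => min (sqDist α y) ((y - t) ^ 2) :=
      (continuous_sqDist α).min (by fun_prop)
    have h2 : ∫ y, sqDist (insert t (α.erase a)) y ∂μ ≤
        ∫ y, min (sqDist α y) ((y - t) ^ 2) ∂μ := by
      refine integral_mono_ae (isTame_sqDist _ _ hμ) (hμ.integrable tm) ?_
      filter_upwards [h0'] with y hya
      obtain ⟨b, hb, hy⟩ := exists_mem_cell h.1 y
      have hab : b ≠ a := fun e => hya (e ▸ hy)
      refine le_min ?_ (sqDist_le (Finset.mem_insert_self _ _) y)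
      rw [sqDist_eq_of_mem_cell hb hy]
      exact sqDist_le (Finset.mem_insert_of_mem (Finset.mem_erase.2 ⟨hab, hb⟩)) y
    have h3 : ∫ y, (sqDist α y - min (sqDist α y) ((y - t) ^ 2)) ∂μ = 0 := by
      refine le_antisymm ?_ (integral_nonneg fun y => sub_nonneg.2 (min_le_left _ _))
      rw [integral_sub (isTame_sqDist _ _ hμ) (hμ.integrable tm)]
      linarith
    rw [integral_eq_zero_iff_of_nonneg (fun y => sub_nonneg.2 (min_le_left _ _))
      ((isTame_sqDist _ _ hμ).sub (hμ.integrable tm))] at h3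
    filter_upwards [h3] with y hy
    have : sqDist α y = min (sqDist α y) ((y - t) ^ 2) := sub_eq_zero.1 hy
    exact this ▸ min_le_right _ _
  refine hfin α ?_
  filter_upwards [ae_all_iff.2 fun q : ℚ => step q] with y hy
  have h1 : sqDist α y ≤ 0 := by
    refine le_of_forall_pos_le_add fun ε hε => ?_
    obtain ⟨q, hq1, hq2⟩ := exists_rat_btwn (lt_add_of_pos_right y (lt_min hε one_pos))
    have h2 := min_le_left ε 1
    have h3 := min_le_right ε 1
    refine (hy q).trans ?_
    nlinarith
  obtain ⟨b, hb, e⟩ := exists_sqDist_eq h.1 y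
  rw [e] at h1
  have : y - b = 0 := pow_eq_zero_iff (two_ne_zero) |>.1 (le_antisymm h1 (sq_nonneg _))
  rwa [sub_eq_zero.1 this]

lemma IsMinimizer.integral_cell_pos (hμ : IsBounded μ) (h : IsMinimizer μ α)
    (hfin : ∀ s : Finset ℝ, ¬ ∀ᵐ y ∂μ, y ∈ s) {a : ℝ} (ha : a ∈ α) {g : ℝ → ℝ}
    (hg : IsTame g) (hpos : ∀ᵐ y ∂μ, y ∈ cell α a → 0 < g y) :
    0 < ∫ y, (cell α a).indicator g y ∂μ := by
  have h0 : 0 ≤ᵐ[μ] (cell α a).indicator g := by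
    filter_upwards [hpos] with y hy
    by_cases hc : y ∈ cell α a
    · simpa [hc] using (hy hc).le
    · simp [hc]
  refine lt_of_le_of_ne (integral_nonneg_of_ae h0) fun e => ?_
  have h1 := (integral_eq_zero_iff_of_nonneg_ae h0 (hg.indicator α a μ hμ)).1 e.symm
  refine h.measure_cell_pos hμ hfin ha (measure_eq_zero_iff_ae_notMem.2 ?_)
  filter_upwards [h1, hpos] with y hy1 hy2 hc
  rw [Set.indicator_of_mem hc] at hy1
  exact (hy2 hc).ne' hy1

end

/-! ### The measures seen at the scale of a basic interval -/

/-- The tail on `[0, 2]`, a multiple of the block on `[3, 4]`, and a remaining part. -/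
noncomputable def levelLaw (θ : ℝ) (ρ : Measure ℝ) : Measure ℝ :=
  tailLaw + ENNReal.ofReal θ • blockLaw + ρ

/-- A finite measure carried by a bounded subset of `[6, ∞)`. -/
def IsFar (ρ : Measure ℝ) : Prop :=
  IsFiniteMeasure ρ ∧ ∃ b : ℝ, ∀ᵐ y ∂ρ, 6 ≤ y ∧ y ≤ b

lemma IsFar.isBounded {ρ : Measure ℝ} (h : IsFar ρ) : IsBounded ρ := ⟨h.1, 6, h.2⟩

lemma isFar_zero : IsFar 0 := ⟨inferInstance, 6, by simp⟩

lemma IsFar.ae {ρ : Measure ℝ} (h : IsFar ρ) : ∀ᵐ y ∂ρ, 6 ≤ y := by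
  obtain ⟨-, b, hb⟩ := h
  exact hb.mono fun y hy => hy.1

lemma isBounded_levelLaw {θ : ℝ} {ρ : Measure ℝ} (h : IsFar ρ) : IsBounded (levelLaw θ ρ) := by
  have h1 := h.1
  obtain ⟨b, hb⟩ := h.2
  have h2 : IsFiniteMeasure (ENNReal.ofReal θ • blockLaw) :=
    Measure.smul_finite _ (by simp)
  refine ⟨by unfold levelLaw; infer_instance, 0, max 4 b, ?_⟩
  rw [levelLaw, ae_add_measure_iff, ae_add_measure_iff]
  refine ⟨⟨?_, Measure.ae_smul_measure ?_ _⟩, ?_⟩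
  · filter_upwards [ae_tailLaw] with y hy
    exact ⟨hy.1, le_max_of_le_left (by linarith [hy.2])⟩
  · filter_upwards [ae_blockLaw] with y hy
    exact ⟨by linarith [hy.1], le_max_of_le_left hy.2⟩
  · filter_upwards [hb] with y hy
    exact ⟨by linarith [hy.1], le_max_of_le_right hy.2⟩

lemma ae_levelLaw {θ : ℝ} {ρ : Measure ℝ} {p : ℝ → Prop} (h1 : ∀ y, 0 ≤ y → y ≤ 2 → p y)
    (h2 : ∀ y, 3 ≤ y → y ≤ 4 → p y) (h3 : ∀ᵐ y ∂ρ, p y) : ∀ᵐ y ∂levelLaw θ ρ, p y := by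
  rw [levelLaw, ae_add_measure_iff, ae_add_measure_iff]
  exact ⟨⟨ae_tailLaw.mono fun y hy => h1 y hy.1 hy.2,
    Measure.ae_smul_measure (ae_blockLaw.mono fun y hy => h2 y hy.1 hy.2) _⟩, h3⟩

lemma integral_levelLaw {θ : ℝ} (hθ : 0 ≤ θ) {ρ : Measure ℝ} (hρ : IsFar ρ) {h : ℝ → ℝ}
    (hh : IsTame h) : ∫ y, h y ∂levelLaw θ ρ =
      ∫ y, h y ∂tailLaw + θ * ∫ y, h y ∂blockLaw + ∫ y, h y ∂ρ := by
  have i1 := hh _ isBounded_tailLaw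
  have i2 := (hh _ isBounded_blockLaw).smul_measure (c := ENNReal.ofReal θ) (by simp)
  rw [levelLaw, integral_add_measure (i1.add_measure i2) (hh _ hρ.isBounded),
    integral_add_measure i1 i2, integral_ofReal_smul _ _ hθ]

/-- The tail contains a copy of itself scaled by 1/2, so a finite carrier contains y / 2^n for every
n and almost every y. This forces y = 0 almost everywhere, against the mean 8/7. -/
lemma tailLaw_not_ae_mem_finset (s : Finset ℝ) : ¬ ∀ᵐ y ∂tailLaw, y ∈ s := by
  intro h
  have step : ∀ p : ℝ → Prop, MeasurableSet {y | p y} → (∀ᵐ y ∂tailLaw, p y) →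
      ∀ᵐ y ∂tailLaw, p (y / 2) := by
    intro p hp h
    rw [tailLaw_eq, ae_add_measure_iff] at h
    have h2 := h.2
    rw [Measure.ae_ennreal_smul_measure_iff (by simp), ae_map_iff (by fun_prop) hp] at h2
    exact h2
  have all : ∀ n : ℕ, ∀ᵐ y ∂tailLaw, y / 2 ^ n ∈ s := by
    intro n
    induction n with
    | zero => simpa using h
    | succ n ih =>
      have := step (fun y => y / 2 ^ n ∈ s)
        ((measurable_id.div_const _) (s.measurableSet)) ih
      filter_upwards [this] with y hy
      rwa [pow_succ', ← div_div]
  have h0 : ∀ᵐ y ∂tailLaw, y = 0 := by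
    filter_upwards [ae_all_iff.2 all] with y hy
    by_contra hne
    refine Set.infinite_of_injective_forall_mem (f := fun n : ℕ => y / 2 ^ n) (fun m n hmn => ?_)
      hy s.finite_toSet
    have h2 : (2 : ℝ) ^ m = 2 ^ n := by
      have : (y / 2 ^ m)⁻¹ = (y / 2 ^ n)⁻¹ := congrArg _ hmn
      rw [inv_div, inv_div] at this
      exact (div_left_inj' hne).1 this
    exact pow_right_injective₀ (by norm_num) (by norm_num) h2
  have := integral_congr_ae (f := fun y : ℝ => y) (g := fun _ => 0) h0
  rw [moments.1.2] at this
  norm_num at this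

lemma levelLaw_not_ae_mem_finset (θ : ℝ) (ρ : Measure ℝ) (s : Finset ℝ) :
    ¬ ∀ᵐ y ∂levelLaw θ ρ, y ∈ s := by
  intro h
  rw [levelLaw, ae_add_measure_iff, ae_add_measure_iff] at h
  exact tailLaw_not_ae_mem_finset s h.1.1

/-! ### Two points in the tail force a point in the block -/

section
variable {θ : ℝ} {ρ : Measure ℝ} {α : Finset ℝ}

lemma IsMinimizer.level_le (h : IsMinimizer (levelLaw θ ρ) α) (hθ : 0 ≤ θ) (hρ : IsFar ρ)
    (β : Finset ℝ) (hβ : β.Nonempty) (hcard : β.card ≤ α.card) :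
    ∫ y, sqDist α y ∂tailLaw + θ * ∫ y, sqDist α y ∂blockLaw + ∫ y, sqDist α y ∂ρ ≤
      ∫ y, sqDist β y ∂tailLaw + θ * ∫ y, sqDist β y ∂blockLaw + ∫ y, sqDist β y ∂ρ := by
  rw [← integral_levelLaw hθ hρ (isTame_sqDist _), ← integral_levelLaw hθ hρ (isTame_sqDist _)]
  exact h.2 β hβ hcard

lemma isTame_cell (α : Finset ℝ) (a : ℝ) : IsTame ((cell α a).indicator fun y => y - a) :=
  IsTame.indicator (Continuous.isTame (by fun_prop)) _ _

lemma IsMinimizer.level_centroid (h : IsMinimizer (levelLaw θ ρ) α) (hθ : 0 ≤ θ) (hρ : IsFar ρ)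
    {a : ℝ} (ha : a ∈ α) :
    ∫ y, (cell α a).indicator (fun y => y - a) y ∂tailLaw +
      θ * ∫ y, (cell α a).indicator (fun y => y - a) y ∂blockLaw +
      ∫ y, (cell α a).indicator (fun y => y - a) y ∂ρ = 0 := by
  rw [← integral_levelLaw hθ hρ (isTame_cell α a)]
  exact h.integral_cell_eq_zero (isBounded_levelLaw hρ) ha

lemma integral_sqDist_nonneg (μ : Measure ℝ) (α : Finset ℝ) : 0 ≤ ∫ y, sqDist α y ∂μ :=
  integral_nonneg (sqDist_nonneg α)

/-- This bound and the next are the variances about the means 24/7 and 8/7. The third averages the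
variances of the two halves of the tail, which are copies of block and tail scaled by 1/2. -/
lemma integral_sqDist_blockLaw_le {β : Finset ℝ} (h : 24 / 7 ∈ β) :
    ∫ y, sqDist β y ∂blockLaw ≤ 288 / 3577 := by
  refine (integral_blockLaw_le (isTame_sqDist β _ isBounded_blockLaw) (9 / 49) (-(6 / 7)) 1
    fun z _ _ => (sqDist_le h _).trans (le_of_eq (by ring))).trans (le_of_eq (by norm_num))

lemma integral_sqDist_tailLaw_le_one {β : Finset ℝ} (h : 8 / 7 ∈ β) :
    ∫ y, sqDist β y ∂tailLaw ≤ 1376 / 3577 := by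
  refine (integral_tailLaw_le (isTame_sqDist β _ isBounded_tailLaw) (64 / 49) (-(16 / 7)) 1
    fun z _ _ => (sqDist_le h _).trans (le_of_eq (by ring))).trans (le_of_eq (by norm_num))

lemma integral_sqDist_tailLaw_le_two {β : Finset ℝ} (h : 4 / 7 ∈ β) (h' : 12 / 7 ∈ β) :
    ∫ y, sqDist β y ∂tailLaw ≤ 208 / 3577 := by
  refine (integral_tailLaw_split_le (isTame_sqDist β _ isBounded_tailLaw)
    (9 / 196) (-(3 / 14)) (1 / 4) (16 / 49) (-(4 / 7)) (1 / 4)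
    (fun z _ _ => (sqDist_le h' _).trans (le_of_eq (by ring)))
    fun z _ _ => (sqDist_le h _).trans (le_of_eq (by ring))).trans (le_of_eq (by norm_num))

/-- If no point of a minimizer lies in the block, the part of the block served from the right can
be charged to the points that lie to the right of the block. -/
lemma IsMinimizer.exists_replace_right (h : IsMinimizer (levelLaw θ ρ) α) (hθ : 0 ≤ θ)
    (hρ : IsFar ρ) (hno : ∀ p ∈ α, p < 3 ∨ 4 < p) :
    ∃ (γ : Finset ℝ) (w : ℝ → ℝ), γ.card ≤ (α.filter (4 < ·)).card ∧ IsTame w ∧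
      (∀ β : Finset ℝ, 24 / 7 ∈ β →
        ∫ y, sqDist (β ∪ γ) y ∂ρ + θ * ∫ y, w y ∂blockLaw ≤ ∫ y, sqDist α y ∂ρ) ∧
      ∀ p ∈ α, ∀ y, 3 ≤ y → y ≤ 4 → y ∈ cell α p →
        (p < 3 → w y = 0) ∧ (4 < p → 2 * (4 - y) ≤ (y - p) ^ 2 + w y) := by
  classical
  set H := α.filter (4 < ·) with hHdef
  by_cases hH : H.Nonempty
  · obtain ⟨b, hb, hmin⟩ := Finset.exists_min_image _ id hH
    have hbH := hb
    rw [hHdef, Finset.mem_filter] at hb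
    obtain ⟨hbα, hb4⟩ := hb
    have hmin' : ∀ p ∈ α, 4 < p → b ≤ p := fun p hp hp4 =>
      hmin p (Finset.mem_filter.2 ⟨hp, hp4⟩)
    -- The leftmost point b beyond the block is pushed to at least 6. For y ≥ 6 this does no harm:
    -- (y - b)² - (y - c)² = (c - b)(y - b) + (c - b)(y - c), and the last term is nonnegative.
    set c := max b 6 with hc
    have hbc : b ≤ c := le_max_left _ _
    have h6c : 6 ≤ c := le_max_right _ _
    have hcb : ∀ y, 6 ≤ y → 0 ≤ (c - b) * (y - c) := by
      intro y hy
      rcases le_total b 6 with hb6 | hb6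
      · rw [hc, max_eq_right hb6]; nlinarith
      · rw [hc, max_eq_left hb6]; simp
    have L := h.level_centroid hθ hρ hbα
    have tm := isTame_cell α b
    have L0 : ∫ y, (cell α b).indicator (fun y => y - b) y ∂tailLaw ≤ 0 := by
      refine integral_nonpos_of_ae (ae_tailLaw.mono fun y hy => ?_)
      exact Set.indicator_apply_le' (fun _ => by simp only [Pi.zero_apply]; linarith [hy.2])
        fun _ => le_rfl
    -- On ρ the gain is at least c - b times the first moment of the cell of b. By the centroid
    -- condition, and since the tail moment is nonpositive, this is at least θ times the integral of
    -- w over the block.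
    refine ⟨insert c (H.erase b),
      fun y => -(c - b) * (cell α b).indicator (fun y => y - b) y, ?_, tm.const_mul _, ?_, ?_⟩
    · refine (Finset.card_insert_le _ _).trans ?_
      rw [Finset.card_erase_of_mem hbH]
      have := Finset.card_pos.2 hH
      omega
    · intro β hβ
      have h1 : ∫ y, sqDist (β ∪ insert c (H.erase b)) y ∂ρ ≤
          ∫ y, (sqDist α y - (c - b) * (cell α b).indicator (fun y => y - b) y) ∂ρ := by
        refine integral_mono_ae (isTame_sqDist _ _ hρ.isBounded)
          ((isTame_sqDist α).sub (tm.const_mul _) _ hρ.isBounded) ?_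
        filter_upwards [hρ.ae] with y hy
        obtain ⟨p, hp, hyp⟩ := exists_mem_cell h.1 y
        rw [sqDist_eq_of_mem_cell hp hyp]
        by_cases hpb : p = b
        · subst hpb
          rw [Set.indicator_of_mem hyp]
          have := hcb y hy
          refine (sqDist_le (Finset.mem_union_right _ (Finset.mem_insert_self _ _)) y).trans ?_
          nlinarith
        · rw [Set.indicator_of_notMem fun hy => hpb (cell_unique hp hbα hyp hy)]
          rw [mul_zero, sub_zero]
          rcases hno p hp with hp3 | hp4
          · refine (sqDist_le (Finset.mem_union_left _ hβ) y).trans ?_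
            nlinarith
          · exact sqDist_le (Finset.mem_union_right _ (Finset.mem_insert_of_mem
              (Finset.mem_erase.2 ⟨hpb, Finset.mem_filter.2 ⟨hp, hp4⟩⟩))) y
      rw [integral_sub (isTame_sqDist _ _ hρ.isBounded) (tm.const_mul _ _ hρ.isBounded),
        integral_const_mul] at h1
      rw [integral_const_mul]
      nlinarith
    · intro p hp y hy3 hy4 hyp
      beta_reduce
      refine ⟨fun hp3 => ?_, fun hp4 => ?_⟩
      · rw [Set.indicator_of_notMem, mul_zero]
        intro hyb
        have := cell_unique hp hbα hyp hyb
        linarith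
      · have hpb : p = b := by
          refine le_antisymm ?_ (hmin' p hp hp4)
          have := (hyp b hbα).1
          rw [abs_of_neg (by linarith), abs_of_neg (by linarith)] at this
          linarith
        subst hpb
        rw [Set.indicator_of_mem hyp]
        -- Here (y - b)² + w y = (b - y)(c - y), with b > 4 and c - y ≥ 2.
        nlinarith [mul_nonneg (sub_nonneg.2 hy4) (sub_nonneg.2 h6c)]
  · refine ⟨∅, fun _ => 0, by simp, Continuous.isTame continuous_const, fun β hβ => ?_, ?_⟩
    · rw [integral_zero, mul_zero, add_zero, Finset.union_empty]
      refine integral_mono_ae (isTame_sqDist _ _ hρ.isBounded) (isTame_sqDist _ _ hρ.isBounded) ?_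
      filter_upwards [hρ.ae] with y hy
      obtain ⟨p, hp, hyp⟩ := exists_mem_cell h.1 y
      rw [sqDist_eq_of_mem_cell hp hyp]
      rcases hno p hp with hp3 | hp4
      · refine (sqDist_le hβ y).trans ?_
        nlinarith
      · exact absurd ⟨p, Finset.mem_filter.2 ⟨hp, hp4⟩⟩ hH
    · intro p hp y _ _ _
      exact ⟨fun _ => rfl, fun hp4 => absurd ⟨p, Finset.mem_filter.2 ⟨hp, hp4⟩⟩ hH⟩

/-- Without a point in [3, 4] the block is served from below 3 or from above 4, both costly. The
points below 3 are exchanged for 4/7, 12/7, 24/7 if one of them exceeds 2 (there are then at least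
three), and for 8/7, 24/7 otherwise. The points above 4 are handled by
`IsMinimizer.exists_replace_right`. -/
theorem IsMinimizer.exists_mem_block (h : IsMinimizer (levelLaw θ ρ) α) (hρ : IsFar ρ)
    (hθ : θ = 1 ∨ θ = 1 / 3 ∧ ∀ p ∈ α, p ≤ 4) (h2 : 2 ≤ (α.filter (· ≤ 2)).card) :
    ∃ p ∈ α, 3 ≤ p ∧ p ≤ 4 := by
  classical
  by_contra! hno'
  have hno : ∀ p ∈ α, p < 3 ∨ 4 < p := fun p hp => by
    rcases lt_or_ge p 3 with h | h
    · exact Or.inl h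
    · exact Or.inr (hno' p hp h)
  have hθ0 : 0 < θ := by rcases hθ with h | h <;> [rw [h]; rw [h.1]] <;> norm_num
  obtain ⟨γ, w, hγ, hw, hR, hJ⟩ := h.exists_replace_right hθ0.le hρ hno
  have hcard : (α.filter (· < 3)).card + (α.filter (4 < ·)).card ≤ α.card := by
    rw [← Finset.card_union_of_disjoint]
    · exact Finset.card_le_card (Finset.union_subset (Finset.filter_subset _ _)
        (Finset.filter_subset _ _))
    · rw [Finset.disjoint_filter]; intro x _ h1; linarith
  have hsub : α.filter (· ≤ 2) ⊆ α.filter (· < 3) := fun p hp => by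
    rw [Finset.mem_filter] at hp ⊢
    exact ⟨hp.1, by linarith [hp.2]⟩
  have tJ := (isTame_sqDist α).add hw
  have eJ : ∫ y, (sqDist α y + w y) ∂blockLaw =
      ∫ y, sqDist α y ∂blockLaw + ∫ y, w y ∂blockLaw :=
    integral_add (isTame_sqDist _ _ isBounded_blockLaw) (hw _ isBounded_blockLaw)
  by_cases hgap : ∃ p ∈ α, 2 < p ∧ p < 3
  · obtain ⟨q, hq, hq2, hq3⟩ := hgap
    obtain ⟨a, ha, hmax⟩ := Finset.exists_max_image (α.filter (· < 3)) id
      ⟨q, Finset.mem_filter.2 ⟨hq, hq3⟩⟩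
    rw [Finset.mem_filter] at ha
    obtain ⟨haα, ha3⟩ := ha
    have hmax' : ∀ p ∈ α, p < 3 → p ≤ a := fun p hp hp3 =>
      hmax p (Finset.mem_filter.2 ⟨hp, hp3⟩)
    have ha2 : 2 < a := lt_of_lt_of_le hq2 (hmax' q hq hq3)
    have h3 : 3 ≤ (α.filter (· < 3)).card := by
      have : insert a (α.filter (· ≤ 2)) ⊆ α.filter (· < 3) := by
        refine Finset.insert_subset (Finset.mem_filter.2 ⟨haα, ha3⟩) hsub
      have := Finset.card_le_card this
      rw [Finset.card_insert_of_notMem (by simp [ha2])] at this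
      omega
    have hβ1 : ({4 / 7, 12 / 7, 24 / 7} : Finset ℝ).card ≤ 3 := Finset.card_le_three
    have opt := h.level_le hθ0.le hρ ({4 / 7, 12 / 7, 24 / 7} ∪ γ)
      ⟨4 / 7, by simp⟩ ((Finset.card_union_le _ _).trans (by omega))
    have oT := integral_sqDist_tailLaw_le_two (β := {4 / 7, 12 / 7, 24 / 7} ∪ γ)
      (by simp) (by simp)
    have oJ := integral_sqDist_blockLaw_le (β := {4 / 7, 12 / 7, 24 / 7} ∪ γ) (by simp)
    have oR := hR {4 / 7, 12 / 7, 24 / 7} (by simp)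
    have tm := isTame_cell α a
    have L := h.level_centroid hθ0.le hρ haα
    set LT := ∫ y, (cell α a).indicator (fun y => y - a) y ∂tailLaw
    set LJ := ∫ y, (cell α a).indicator (fun y => y - a) y ∂blockLaw
    have LR : 0 ≤ ∫ y, (cell α a).indicator (fun y => y - a) y ∂ρ := by
      refine integral_nonneg_of_ae (hρ.ae.mono fun y hy => ?_)
      exact Set.indicator_apply_nonneg fun _ => by linarith
    -- The multiplier a - 2 is the largest that costs nothing on the tail, where y ≤ 2 gives (y -
    -- a)² ≥ -(a - 2)(y - a). On the block it raises (y - a)² to (y - a)(y - 2) ≥ z (1 + z), with y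
    -- = 3 + z.
    have cT : -(a - 2) * LT ≤ ∫ y, sqDist α y ∂tailLaw := by
      rw [← integral_const_mul]
      refine integral_mono_ae (tm.const_mul _ _ isBounded_tailLaw)
        (isTame_sqDist _ _ isBounded_tailLaw) ?_
      filter_upwards [ae_tailLaw] with y hy
      by_cases hya : y ∈ cell α a
      · rw [Set.indicator_of_mem hya, sqDist_eq_of_mem_cell haα hya]
        nlinarith [hy.2]
      · rw [Set.indicator_of_notMem hya, mul_zero]
        exact sqDist_nonneg _ _
    have L' : (a - 2) * LT + θ * ((a - 2) * LJ) ≤ 0 := by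
      have : 0 ≤ (a - 2) * ∫ y, (cell α a).indicator (fun y => y - a) y ∂ρ :=
        mul_nonneg (by linarith) LR
      linear_combination this + (a - 2) * L
    have tt : IsTame fun y => sqDist α y + w y +
        (a - 2) * (cell α a).indicator (fun y => y - a) y := tJ.add (tm.const_mul _)
    have eJ' : ∫ y, (sqDist α y + w y +
        (a - 2) * (cell α a).indicator (fun y => y - a) y) ∂blockLaw =
        ∫ y, sqDist α y ∂blockLaw + ∫ y, w y ∂blockLaw + (a - 2) * LJ := by
      rw [integral_add (tJ _ isBounded_blockLaw) (tm.const_mul _ _ isBounded_blockLaw), eJ,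
        integral_const_mul]
    have hlow : ∀ p ∈ α, ∀ z, 0 ≤ z → z ≤ 1 → 3 + z ∈ cell α p → p < 3 →
        z * (1 + z) ≤ sqDist α (3 + z) + w (3 + z) +
          (a - 2) * (cell α a).indicator (fun y => y - a) (3 + z) := by
      intro p hp z h0 h1 hzp hp3
      have hpa : p = a := by
        refine le_antisymm (hmax' p hp hp3) ?_
        have := (hzp a haα).1
        rw [abs_of_pos (by linarith), abs_of_pos (by linarith)] at this
        linarith
      subst hpa
      rw [(hJ p hp _ (by linarith) (by linarith) hzp).1 hp3, Set.indicator_of_mem hzp,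
        sqDist_eq_of_mem_cell hp hzp]
      nlinarith [mul_nonneg h0 (sub_nonneg.2 ha3.le)]
    rcases hθ with hθ | ⟨hθ, hα4⟩
    · subst hθ
      -- z - z² lies below both z (1 + z), for service from the left, and 2 (1 - z), for service
      -- from the right. Its mean 588/3577 exceeds the new error 208/3577 + 288/3577.
      have := le_integral_blockLaw (tt _ isBounded_blockLaw) 0 1 (-1) fun z h0 h1 => by
        obtain ⟨p, hp, hzp⟩ := exists_mem_cell h.1 (3 + z)
        rcases hno p hp with hp3 | hp4
        · refine le_trans ?_ (hlow p hp z h0 h1 hzp hp3)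
          nlinarith
        · have h5 := (hJ p hp _ (by linarith) (by linarith) hzp).2 hp4
          rw [Set.indicator_of_notMem fun hh => by
            have := cell_unique hp haα hzp hh
            linarith, sqDist_eq_of_mem_cell hp hzp]
          nlinarith
      rw [eJ'] at this
      norm_num at this
      linarith
    · have := le_integral_blockLaw (tt _ isBounded_blockLaw) 0 1 1 fun z h0 h1 => by
        obtain ⟨p, hp, hzp⟩ := exists_mem_cell h.1 (3 + z)
        refine le_trans (le_of_eq (by ring)) (hlow p hp z h0 h1 hzp ?_)
        rcases hno p hp with hp3 | hp4
        · exact hp3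
        · exact absurd (hα4 p hp) (by linarith)
      rw [eJ'] at this
      subst hθ
      norm_num at this
      linarith
  · have hgap : ∀ p ∈ α, p < 3 → p ≤ 2 := fun p hp h3 => by
      by_contra! h2
      exact hgap ⟨p, hp, h2, h3⟩
    have hβ1 : ({8 / 7, 24 / 7} : Finset ℝ).card ≤ 2 := Finset.card_le_two
    have h3 := Finset.card_le_card hsub
    have opt := h.level_le hθ0.le hρ ({8 / 7, 24 / 7} ∪ γ)
      ⟨8 / 7, by simp⟩ ((Finset.card_union_le _ _).trans (by omega))
    have oT := integral_sqDist_tailLaw_le_one (β := {8 / 7, 24 / 7} ∪ γ) (by simp)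
    have oJ := integral_sqDist_blockLaw_le (β := {8 / 7, 24 / 7} ∪ γ) (by simp)
    have oR := hR {8 / 7, 24 / 7} (by simp)
    have cT := integral_sqDist_nonneg tailLaw α
    have hlow : ∀ p ∈ α, ∀ z, 0 ≤ z → z ≤ 1 → 3 + z ∈ cell α p → p < 3 →
        (1 + z) ^ 2 ≤ sqDist α (3 + z) + w (3 + z) := by
      intro p hp z h0 h1 hzp hp3
      rw [(hJ p hp _ (by linarith) (by linarith) hzp).1 hp3, sqDist_eq_of_mem_cell hp hzp]
      have := hgap p hp hp3
      nlinarith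
    rcases hθ with hθ | ⟨hθ, hα4⟩
    · subst hθ
      -- 1 - z lies below both (1 + z)² and 2 (1 - z). Its mean 4/7 exceeds the new error 1664/3577.
      have := le_integral_blockLaw (tJ _ isBounded_blockLaw) 1 (-1) 0 fun z h0 h1 => by
        obtain ⟨p, hp, hzp⟩ := exists_mem_cell h.1 (3 + z)
        rcases hno p hp with hp3 | hp4
        · refine le_trans ?_ (hlow p hp z h0 h1 hzp hp3)
          nlinarith
        · have h5 := (hJ p hp _ (by linarith) (by linarith) hzp).2 hp4
          rw [sqDist_eq_of_mem_cell hp hzp]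
          nlinarith
      rw [eJ] at this
      norm_num at this
      linarith
    · have := le_integral_blockLaw (tJ _ isBounded_blockLaw) 1 2 1 fun z h0 h1 => by
        obtain ⟨p, hp, hzp⟩ := exists_mem_cell h.1 (3 + z)
        refine le_trans (le_of_eq (by ring)) (hlow p hp z h0 h1 hzp ?_)
        rcases hno p hp with hp3 | hp4
        · exact hp3
        · exact absurd (hα4 p hp) (by linarith)
      rw [eJ] at this
      subst hθ
      norm_num at this
      linarith

end

/-! ### No point of a minimizer lies between the tail and the block -/

section
variable {θ : ℝ} {ρ : Measure ℝ} {α : Finset ℝ}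

/-- The remaining part is served by points to the right of the block. -/
def IsServedRight (ρ : Measure ℝ) (α : Finset ℝ) : Prop :=
  ∀ᵐ y ∂ρ, ∀ p ∈ α, y ∈ cell α p → 4 < p

lemma isServedRight_zero (α : Finset ℝ) : IsServedRight 0 α := by simp [IsServedRight]

/-- A point y ≥ 6 is within y - 4 of d, hence no farther from d than from any p ≤ 4. Equality can
occur (y = 6, d = 8, p = 4), and then the tie goes to d. -/
lemma IsFar.isServedRight (hρ : IsFar ρ) {d : ℝ} (hd : d ∈ α) (h6 : 6 ≤ d) (h8 : d ≤ 8) :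
    IsServedRight ρ α := by
  filter_upwards [hρ.ae] with y hy p _ hyp
  by_contra! hp4
  have h1 := (hyp d hd).2 (by linarith)
  rw [abs_of_nonneg (by linarith : 0 ≤ y - p)] at h1
  have h2 : |y - d| ≤ y - 4 := abs_le.2 ⟨by linarith, by linarith⟩
  linarith

lemma integral_far_sqDist_le (hα : α.Nonempty) (hρ : IsFar ρ) (hd : IsServedRight ρ α)
    {β : Finset ℝ} (hβ : ∀ p ∈ α, 4 < p → p ∈ β) :
    ∫ y, sqDist β y ∂ρ ≤ ∫ y, sqDist α y ∂ρ := by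
  refine integral_mono_ae (isTame_sqDist _ _ hρ.isBounded) (isTame_sqDist _ _ hρ.isBounded) ?_
  filter_upwards [hd] with y hy
  obtain ⟨p, hp, hyp⟩ := exists_mem_cell hα y
  rw [sqDist_eq_of_mem_cell hp hyp]
  exact sqDist_le (hβ p hp (hy p hp hyp)) y

lemma integral_far_cell_eq_zero (hd : IsServedRight ρ α) {a : ℝ} (haα : a ∈ α)
    (ha : a ≤ 4) : ∫ y, (cell α a).indicator (fun y => y - a) y ∂ρ = 0 := by
  refine integral_eq_zero_of_ae ?_
  filter_upwards [hd] with y hy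
  exact Set.indicator_of_notMem (fun hya => absurd (hy a haα hya) (not_lt.2 ha)) _

/-- Every cell has positive mass and first moment zero about its point, so it cannot lie strictly on
one side. -/
lemma IsMinimizer.not_ae_lt (h : IsMinimizer (levelLaw θ ρ) α) (hρ : IsFar ρ) {a : ℝ}
    (ha : a ∈ α) : ¬ ∀ᵐ y ∂levelLaw θ ρ, y ∈ cell α a → y < a := by
  intro hlt
  have h1 := h.integral_cell_pos (isBounded_levelLaw hρ) (levelLaw_not_ae_mem_finset θ ρ) ha
    (g := fun y => a - y) (Continuous.isTame (by fun_prop))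
    (hlt.mono fun y hy hya => sub_pos.2 (hy hya))
  have h2 := h.integral_cell_eq_zero (isBounded_levelLaw hρ) ha
  have h3 : ∀ y, (cell α a).indicator (fun y => a - y) y =
      -(cell α a).indicator (fun y => y - a) y := fun y => by
    by_cases hy : y ∈ cell α a <;> simp [hy]
  simp_rw [h3] at h1
  rw [integral_neg, h2] at h1
  simp at h1

lemma IsMinimizer.not_ae_gt (h : IsMinimizer (levelLaw θ ρ) α) (hρ : IsFar ρ) {a : ℝ}
    (ha : a ∈ α) : ¬ ∀ᵐ y ∂levelLaw θ ρ, y ∈ cell α a → a < y := by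
  intro hlt
  have h1 := h.integral_cell_pos (isBounded_levelLaw hρ) (levelLaw_not_ae_mem_finset θ ρ) ha
    (g := fun y => y - a) (Continuous.isTame (by fun_prop))
    (hlt.mono fun y hy hya => sub_pos.2 (hy hya))
  rw [h.integral_cell_eq_zero (isBounded_levelLaw hρ) ha] at h1
  exact lt_irrefl _ h1

/-- Adding the mean of the first block of the tail improves on a set whose points below `2` stay
away from that block. -/
lemma integral_tail_sub_le {a σ : ℝ} (hα : α.Nonempty) (hσ : 0 ≤ σ) (hσa : σ ≤ a - 5 / 2)
    (hlow : ∀ p ∈ α, p ≤ 4 - a ∨ a ≤ p) {β : Finset ℝ} (hβ : 12 / 7 ∈ β)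
    (hβα : ∀ p ∈ α, p ≤ 4 - a → p ∈ β) :
    ∫ y, sqDist β y ∂tailLaw - ∫ y, sqDist α y ∂tailLaw ≤
      1 / 2 * (9 / 196 - σ ^ 2 - (3 / 14 + σ) * (3 / 7)) := by
  rw [← integral_sub (isTame_sqDist _ _ isBounded_tailLaw) (isTame_sqDist _ _ isBounded_tailLaw)]
  refine (integral_tailLaw_split_le
    ((isTame_sqDist β).sub (isTame_sqDist α) _ isBounded_tailLaw)
    (9 / 196 - σ ^ 2) (-(3 / 14 + σ)) 0 0 0 0 (fun z h0 h1 => ?_)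
    fun t h0 h2 => ?_).trans (le_of_eq (by ring))
  -- At y = (3 + z)/2 the new error is at most (z/2 - 3/14)² and the old one at least (σ + z/2)².
  -- The squares of z cancel and a linear bound remains.
  · have u := sqDist_le hβ ((3 + z) / 2)
    have l : (σ + z / 2) ^ 2 ≤ sqDist α ((3 + z) / 2) := by
      refine le_sqDist hα fun p hp => ?_
      rcases hlow p hp with hp | hp
      · exact pow_le_pow_left₀ (by positivity) (by linarith) 2
      · rw [← neg_sub, neg_sq]
        exact pow_le_pow_left₀ (by positivity) (by linarith) 2
    nlinarith
  · obtain ⟨p, hp, e⟩ := exists_sqDist_eq hα (t / 2)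
    rw [e]
    rcases hlow p hp with hp' | hp'
    · have := sqDist_le (hβα p hp hp') (t / 2)
      linarith
    · have := sqDist_le hβ (t / 2)
      nlinarith

/-- A point a of the gap is the only one there, and by reflection in 2 the points below it stay
under 4 - a; the upper half of the tail is then badly served when a is large. Three ranges of a call
for three replacements: a and b by two means, a by 2, or a by 12/7. -/
theorem IsMinimizer.not_mem_gap (h : IsMinimizer (levelLaw θ ρ) α) (hρ : IsFar ρ)
    (hθ : 0 < θ) (hθ1 : θ ≤ 1)
    (hb : ∃ p ∈ α, 3 ≤ p ∧ p ≤ 4) (hd : IsServedRight ρ α) {a : ℝ} (ha : a ∈ α) :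
    ¬ (2 < a ∧ a < 3) := by
  classical
  rintro ⟨ha2, ha3⟩
  obtain ⟨b, hb, hmin⟩ := Finset.exists_min_image (α.filter fun p => 3 ≤ p ∧ p ≤ 4) id
    (by obtain ⟨p, hp⟩ := hb; exact ⟨p, Finset.mem_filter.2 hp⟩)
  rw [Finset.mem_filter] at hb
  obtain ⟨hbα, hb3, hb4⟩ := hb
  -- Of two gap points the left one would serve only tail points, all to its left.
  have not_gap_lt : ∀ p ∈ α, ∀ q ∈ α, 2 < p → p < q → ¬ q < 3 := by
    intro p hp q hq hp2 hpq hq3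
    refine h.not_ae_lt hρ hp (ae_levelLaw (fun y _ hy2 _ => by linarith) ?_ ?_)
    · intro y hy3 _ hyp
      have := (hyp q hq).1
      rw [abs_of_pos (by linarith), abs_of_pos (by linarith)] at this
      linarith
    · filter_upwards [hd] with y hy hyp
      linarith [hy p hp hyp]
  have hsplit : ∀ p ∈ α, p ≤ 2 ∨ p = a ∨ b ≤ p := by
    intro p hp
    rcases le_or_gt p 2 with hp2 | hp2
    · exact Or.inl hp2
    · right
      rcases lt_or_ge p 3 with hp3 | hp3
      · left
        rcases lt_trichotomy p a with hpa | hpa | hpa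
        · exact absurd ha3 (not_gap_lt p hp a ha hp2 hpa)
        · exact hpa
        · exact absurd hp3 (not_gap_lt a ha p hp ha2 hpa)
      · right
        rcases le_or_gt p 4 with hp4 | hp4
        · exact hmin p (Finset.mem_filter.2 ⟨hp, hp3, hp4⟩)
        · linarith
  -- If the midpoint of p and a were above 2, then p would take the whole tail from a, which would
  -- serve only points to its right.
  have hlow2 : ∀ p ∈ α, p ≤ 2 → p ≤ 4 - a := by
    intro p hp hp2
    by_contra! hpa
    refine h.not_ae_gt hρ ha (ae_levelLaw (fun y _ hy2 hya => ?_) (fun y hy3 _ _ => by linarith) ?_)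
    · have h1 := (hya p hp).1
      rw [abs_of_neg (by linarith)] at h1
      have h2 : |y - p| < a - y := abs_lt.2 ⟨by linarith, by linarith⟩
      linarith
    · filter_upwards [hρ.ae] with y hy _
      linarith
  have hlow : ∀ p ∈ α, p ≤ 4 - a ∨ a ≤ p := by
    intro p hp
    rcases hsplit p hp with hp2 | hp2 | hp2
    · exact Or.inl (hlow2 p hp hp2)
    · exact Or.inr hp2.ge
    · right; linarith
  have hmid : ∀ y, y ∈ cell α a → 2 * y ≤ a + b := by
    intro y hy
    have := sq_le_sq.2 (hy b hbα).1
    nlinarith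
  have hblock : ∀ y, 3 ≤ y → ∀ p ∈ α, y ∈ cell α p → p = a ∨ b ≤ p := by
    intro y hy p hp hyp
    rcases hsplit p hp with hp2 | hp2
    · have := (hyp a ha).1
      rw [abs_of_pos (by linarith), abs_of_pos (by linarith)] at this
      linarith
    · exact hp2
  have hR : ∀ β : Finset ℝ, (∀ p ∈ α, 4 < p → p ∈ β) →
      ∫ y, sqDist β y ∂ρ ≤ ∫ y, sqDist α y ∂ρ := fun β hβ =>
    integral_far_sqDist_le h.1 hρ hd hβ
  have hpos : 0 < α.card := Finset.card_pos.2 h.1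
  rcases le_or_gt (27 / 10) a with ha27 | ha27
  -- With σ = 1/5 the gain on the upper half of the tail exceeds 288/3577, the full variance of the
  -- block.
  · -- both points move to block means
    set β : Finset ℝ := insert (12 / 7) (insert (24 / 7) ((α.erase a).erase b)) with hβ
    have hba : b ∈ α.erase a := Finset.mem_erase.2 ⟨by linarith, hbα⟩
    have hcard : β.card ≤ α.card := by
      have h1 := Finset.card_insert_le (12 / 7) (insert (24 / 7) ((α.erase a).erase b))
      have h2 := Finset.card_insert_le (24 / 7) ((α.erase a).erase b)
      have h3 := Finset.card_pos.2 ⟨b, hba⟩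
      rw [Finset.card_erase_of_mem hba] at h2
      rw [Finset.card_erase_of_mem ha] at h2 h3
      rw [← hβ] at h1
      omega
    have hmem : ∀ p ∈ α, p ≠ a → p ≠ b → p ∈ β := fun p hp h1 h2 =>
      Finset.mem_insert_of_mem (Finset.mem_insert_of_mem
        (Finset.mem_erase.2 ⟨h2, Finset.mem_erase.2 ⟨h1, hp⟩⟩))
    have opt := h.level_le hθ.le hρ β ⟨_, Finset.mem_insert_self _ _⟩ hcard
    have oT := integral_tail_sub_le (a := a) (σ := 1 / 5) h.1 (by norm_num) (by linarith) hlow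
      (β := β) (Finset.mem_insert_self _ _)
      (fun p hp hpa => hmem p hp (by linarith) (by linarith))
    have oJ := integral_sqDist_blockLaw_le (β := β)
      (Finset.mem_insert_of_mem (Finset.mem_insert_self _ _))
    have oR := hR β fun p hp hp4 => hmem p hp (by linarith) (by linarith)
    have cJ := mul_nonneg hθ.le (integral_sqDist_nonneg blockLaw α)
    have oJ' := mul_le_mul hθ1 oJ (integral_sqDist_nonneg blockLaw β) zero_le_one
    norm_num at oT
    linarith
  -- 18/5 is the mean of the two parts of the block nearest 4, of masses 1/4 and 3/8. If b were
  -- larger, then (a + b)/2 < 27/8, so b would serve the second part entirely; the parts below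
  -- contribute nothing positive, and the first moment of its cell would be negative.
  · have hb36 : b ≤ 18 / 5 := by
      by_contra! hb36
      have L := h.level_centroid hθ.le hρ hbα
      rw [integral_far_cell_eq_zero hd hbα hb4] at L
      have LT : ∫ y, (cell α b).indicator (fun y => y - b) y ∂tailLaw ≤ 0 := by
        refine integral_nonpos_of_ae (ae_tailLaw.mono fun y hy => ?_)
        exact Set.indicator_apply_le' (fun _ => by simp only [Pi.zero_apply]; linarith [hy.2])
          fun _ => le_rfl
      have LJ := integral_blockLaw_split_le (isTame_cell α b _ isBounded_blockLaw)
        (3 / 20) (1 / 4) 0 (27 / 8 - b) (1 / 8) 0 0 0 0 (fun z h0 h1 => ?_) (fun z h0 h1 => ?_)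
        (fun z h0 h2 => ?_)
      · have L0 : 0 ≤ ∫ y, (cell α b).indicator (fun y => y - b) y ∂blockLaw := by
          by_contra! hneg
          have := mul_neg_of_pos_of_neg hθ hneg
          linarith
        linarith
      · exact Set.indicator_apply_le' (fun _ => by linarith) fun _ => by linarith
      · obtain ⟨p, hp, hyp⟩ := exists_mem_cell h.1 (3 + (3 + z) / 8)
        have hpb : p = b := by
          rcases hblock _ (by linarith) p hp hyp with hpa | hpb
          · subst hpa
            have := hmid _ hyp
            linarith
          · refine le_antisymm ?_ hpb
            have := (hyp b hbα).1
            rw [abs_of_neg (by linarith), abs_of_neg (by linarith)] at this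
            linarith
        subst hpb
        rw [Set.indicator_of_mem hyp]
        linarith
      · exact Set.indicator_apply_le' (fun _ => by linarith) fun _ => by linarith
    rcases le_or_gt a (13 / 5) with ha26 | ha26
    · -- the point moves to the end of the tail
      have hcard : (insert 2 (α.erase a)).card ≤ α.card := by
        have h1 := Finset.card_insert_le 2 (α.erase a)
        rw [Finset.card_erase_of_mem ha] at h1
        omega
      have hmem : ∀ p ∈ α, p ≠ a → p ∈ insert 2 (α.erase a) := fun p hp h1 =>
        Finset.mem_insert_of_mem (Finset.mem_erase.2 ⟨h1, hp⟩)
      have opt := h.level_le hθ.le hρ _ ⟨_, Finset.mem_insert_self 2 (α.erase a)⟩ hcard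
      have oR := hR (insert 2 (α.erase a)) fun p hp hp4 => hmem p hp (by linarith)
      have tm := isTame_cell α a
      have L := h.level_centroid hθ.le hρ ha
      rw [integral_far_cell_eq_zero hd ha (by linarith)] at L
      -- If a served no mass in the block, its cell would lie in the tail, strictly to its left.
      -- This positivity makes the final inequality strict.
      have Lpos : 0 < ∫ y, (cell α a).indicator (fun y => y - a) y ∂blockLaw := by
        by_contra! hle
        have hJ0 : ∫ y, (cell α a).indicator (fun y => y - a) y ∂blockLaw = 0 := by
          refine le_antisymm hle (integral_nonneg_of_ae (ae_blockLaw.mono fun y hy => ?_))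
          exact Set.indicator_apply_nonneg fun _ => by linarith [hy.1]
        rw [hJ0] at L
        have g0 := h.integral_cell_pos (isBounded_levelLaw hρ) (levelLaw_not_ae_mem_finset θ ρ) ha
          (g := fun y => |y - a|) (Continuous.isTame (by fun_prop))
          (ae_levelLaw (fun y _ hy _ => abs_pos.2 (by linarith))
            (fun y hy _ _ => abs_pos.2 (by linarith))
            (hρ.ae.mono fun y hy _ => abs_pos.2 (by linarith)))
        rw [integral_levelLaw hθ.le hρ
          (IsTame.indicator (Continuous.isTame (by fun_prop)) _ _)] at g0
        have e1 : ∫ y, (cell α a).indicator (fun y => |y - a|) y ∂tailLaw =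
            ∫ y, -(cell α a).indicator (fun y => y - a) y ∂tailLaw := by
          refine integral_congr_ae (ae_tailLaw.mono fun y hy => ?_)
          by_cases hya : y ∈ cell α a
          · simp only [Set.indicator_of_mem hya]
            exact abs_of_neg (by linarith [hy.2])
          · simp [hya]
        have e2 : ∫ y, (cell α a).indicator (fun y => |y - a|) y ∂blockLaw =
            ∫ y, (cell α a).indicator (fun y => y - a) y ∂blockLaw := by
          refine integral_congr_ae (ae_blockLaw.mono fun y hy => ?_)
          by_cases hya : y ∈ cell α a
          · simp only [Set.indicator_of_mem hya]
            exact abs_of_pos (by linarith [hy.1])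
          · simp [hya]
        have e3 : ∫ y, (cell α a).indicator (fun y => |y - a|) y ∂ρ = 0 := by
          refine integral_eq_zero_of_ae (hd.mono fun y hy => ?_)
          exact Set.indicator_of_notMem (fun hya => absurd (hy a ha hya) (by linarith)) _
        rw [e1, e2, e3, integral_neg, hJ0] at g0
        linarith
      have oT : ∫ y, sqDist (insert 2 (α.erase a)) y ∂tailLaw ≤
          ∫ y, (sqDist α y + (a - 2) * (cell α a).indicator (fun y => y - a) y) ∂tailLaw := by
        refine integral_mono_ae (isTame_sqDist _ _ isBounded_tailLaw)
          ((isTame_sqDist α).add (tm.const_mul _) _ isBounded_tailLaw) ?_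
        filter_upwards [ae_tailLaw] with y hy
        obtain ⟨p, hp, hyp⟩ := exists_mem_cell h.1 y
        rw [sqDist_eq_of_mem_cell hp hyp]
        by_cases hpa : p = a
        · subst hpa
          rw [Set.indicator_of_mem hyp]
          refine (sqDist_le (Finset.mem_insert_self _ _) y).trans ?_
          nlinarith [mul_nonneg (sub_nonneg.2 ha2.le) (sub_nonneg.2 hy.2)]
        · rw [Set.indicator_of_notMem fun hya => hpa (cell_unique hp ha hyp hya), mul_zero,
            add_zero]
          exact sqDist_le (hmem p hp hpa) y
      -- Block points that used a pass to b ≤ 18/5. The bound a ≤ 13/5 leaves a margin of 1/10 in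
      -- the multiplier a - 2 that balances the tail.
      have oJ : ∫ y, sqDist (insert 2 (α.erase a)) y ∂blockLaw ≤
          ∫ y, (sqDist α y + (a - 2 - 1 / 10) * (cell α a).indicator (fun y => y - a) y)
            ∂blockLaw := by
        refine integral_mono_ae (isTame_sqDist _ _ isBounded_blockLaw)
          ((isTame_sqDist α).add (tm.const_mul _) _ isBounded_blockLaw) ?_
        filter_upwards [ae_blockLaw] with y hy
        obtain ⟨p, hp, hyp⟩ := exists_mem_cell h.1 y
        rw [sqDist_eq_of_mem_cell hp hyp]
        by_cases hpa : p = a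
        · subst hpa
          rw [Set.indicator_of_mem hyp]
          refine (sqDist_le (hmem b hbα (by linarith)) y).trans ?_
          have h1 := hmid y hyp
          have h2 : (y - b) ^ 2 ≤ (18 / 5 - y) ^ 2 := by nlinarith
          have h3 : (2 / 5 + (y - 3)) * (9 / 10 + (y - 3)) ≤ (y - p) * (y - 2 - 1 / 10) := by
            have := hy.1
            refine mul_le_mul (by linarith) (by linarith) (by linarith) (by linarith)
          nlinarith [hy.1]
        · rw [Set.indicator_of_notMem fun hya => hpa (cell_unique hp ha hyp hya), mul_zero,
            add_zero]
          exact sqDist_le (hmem p hp hpa) y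
      rw [integral_add (isTame_sqDist _ _ isBounded_tailLaw)
        (tm.const_mul _ _ isBounded_tailLaw), integral_const_mul] at oT
      rw [integral_add (isTame_sqDist _ _ isBounded_blockLaw)
        (tm.const_mul _ _ isBounded_blockLaw), integral_const_mul] at oJ
      have L2 : (a - 2) * ∫ y, (cell α a).indicator (fun y => y - a) y ∂tailLaw =
          -(θ * ((a - 2) * ∫ y, (cell α a).indicator (fun y => y - a) y ∂blockLaw)) := by
        linear_combination (a - 2) * L
      have oJ' := mul_le_mul_of_nonneg_left oJ hθ.le
      have Lpos' := mul_pos hθ Lpos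
      linarith
    · -- the point moves to the mean of the first block of the tail
      have hcard : (insert (12 / 7) (α.erase a)).card ≤ α.card := by
        have h1 := Finset.card_insert_le (12 / 7) (α.erase a)
        rw [Finset.card_erase_of_mem ha] at h1
        omega
      set β : Finset ℝ := insert (12 / 7) (α.erase a) with hβ
      have hmem : ∀ p ∈ α, p ≠ a → p ∈ β := fun p hp h1 =>
        Finset.mem_insert_of_mem (Finset.mem_erase.2 ⟨h1, hp⟩)
      have opt := h.level_le hθ.le hρ β ⟨_, Finset.mem_insert_self _ _⟩ hcard
      have oR := hR β fun p hp hp4 => hmem p hp (by linarith)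
      have oT := integral_tail_sub_le (a := a) (σ := 1 / 10) h.1 (by norm_num) (by linarith) hlow
        (β := β) (Finset.mem_insert_self _ _) (fun p hp hpa => hmem p hp (by linarith))
      have away : ∀ y, 27 / 8 ≤ y → sqDist β y - sqDist α y ≤ 0 := by
        intro y hy
        obtain ⟨p, hp, hyp⟩ := exists_mem_cell h.1 y
        rw [sqDist_eq_of_mem_cell hp hyp]
        refine sub_nonpos.2 (sqDist_le (hmem p hp ?_) y)
        rintro rfl
        have := hmid y hyp
        linarith
      -- Only y = 3 + z/8 can lose, by at most u = 3/10 - z/4, since b - a ≤ 1 and a + b ≤ 63/10.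
      -- The quadratic is (5/3)(u + 3/20)², which dominates both u and 0.
      have oJ := integral_blockLaw_split_le
        ((isTame_sqDist β).sub (isTame_sqDist α) _ isBounded_blockLaw)
        0 0 0 0 0 0 (27 / 80) (-(3 / 8)) (5 / 48)
        (fun z h0 h1 => (away _ (by linarith)).trans (by norm_num))
        (fun z h0 h1 => (away _ (by linarith)).trans (by norm_num))
        (fun z h0 h2 => by
          obtain ⟨p, hp, hyp⟩ := exists_mem_cell h.1 (3 + z / 8)
          rw [sqDist_eq_of_mem_cell hp hyp]
          by_cases hpa : p = a
          · subst hpa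
            have h3 := sqDist_le (hmem b hbα (by linarith)) (3 + z / 8)
            have h4 := hmid _ hyp
            have h5 : (b - p) * (p + b - 2 * (3 + z / 8)) ≤ 1 * (3 / 10 - z / 4) :=
              mul_le_mul (by linarith) (by linarith) (by linarith) (by norm_num)
            nlinarith [sq_nonneg (3 / 20 - z / 4)]
          · have h3 := sqDist_le (hmem p hp hpa) (3 + z / 8)
            nlinarith [sq_nonneg (9 / 20 - z / 4)])
      rw [integral_sub (isTame_sqDist _ _ isBounded_blockLaw)
        (isTame_sqDist _ _ isBounded_blockLaw)] at oJ
      have oJ' := mul_le_mul_of_nonneg_left oJ hθ.le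
      norm_num at oT oJ'
      linarith

end

/-! ### Points of a minimizer in the tail and in the block -/

section
variable {ρ : Measure ℝ} {α : Finset ℝ}

lemma three_le_of_mem_cell (hb : ∃ p ∈ α, 3 ≤ p ∧ p ≤ 4) (hgap : ∀ p ∈ α, p ≤ 2 ∨ 3 ≤ p)
    {p y : ℝ} (hp : p ∈ α) (hy3 : 3 ≤ y) (hy4 : y ≤ 4) (hyp : y ∈ cell α p) : 3 ≤ p := by
  obtain ⟨b, hb, hb3, hb4⟩ := hb
  rcases hgap p hp with hp2 | hp3
  · have h1 := (hyp b hb).2 (by linarith)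
    rw [abs_of_nonneg (by linarith : 0 ≤ y - p)] at h1
    have h2 : |y - b| ≤ 1 := abs_le.2 ⟨by linarith, by linarith⟩
    linarith
  · exact hp3

lemma card_filter_le_add (α : Finset ℝ) (r : ℝ) :
    (α.filter (· ≤ r)).card + (α.filter (r < ·)).card = α.card := by
  rw [← Finset.card_filter_add_card_filter_not (s := α) (· ≤ r)]
  simp only [not_le]

/-- The block and ρ are served by points at or above 3, which are kept. The points up to 2 can
therefore be exchanged for 4/7 and 12/7 with an effect on the tail alone. -/
lemma IsMinimizer.tail_le_of_two (h : IsMinimizer (levelLaw 1 ρ) α) (hρ : IsFar ρ)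
    (hd : IsServedRight ρ α) (hb : ∃ p ∈ α, 3 ≤ p ∧ p ≤ 4) (hgap : ∀ p ∈ α, p ≤ 2 ∨ 3 ≤ p)
    (h2 : 2 ≤ (α.filter (· ≤ 2)).card) : ∫ y, sqDist α y ∂tailLaw ≤ 208 / 3577 := by
  classical
  have hc := card_filter_le_add α 2
  have hc2 : ({4 / 7, 12 / 7} : Finset ℝ).card ≤ 2 := Finset.card_le_two
  have hmem : ∀ p ∈ α, 2 < p → p ∈ ({4 / 7, 12 / 7} : Finset ℝ) ∪ α.filter (2 < ·) :=
    fun p hp hp2 => Finset.mem_union_right _ (Finset.mem_filter.2 ⟨hp, hp2⟩)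
  have opt := h.level_le zero_le_one hρ ({4 / 7, 12 / 7} ∪ α.filter (2 < ·))
    ⟨4 / 7, by simp⟩ ((Finset.card_union_le _ _).trans (by omega))
  have oT := integral_sqDist_tailLaw_le_two (β := {4 / 7, 12 / 7} ∪ α.filter (2 < ·))
    (by simp) (by simp)
  have oR := integral_far_sqDist_le h.1 hρ hd (β := {4 / 7, 12 / 7} ∪ α.filter (2 < ·))
    fun p hp hp4 => hmem p hp (by linarith)
  have oJ : ∫ y, sqDist ({4 / 7, 12 / 7} ∪ α.filter (2 < ·)) y ∂blockLaw ≤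
      ∫ y, sqDist α y ∂blockLaw := by
    refine integral_mono_ae (isTame_sqDist _ _ isBounded_blockLaw)
      (isTame_sqDist _ _ isBounded_blockLaw) (ae_blockLaw.mono fun y hy => ?_)
    obtain ⟨p, hp, hyp⟩ := exists_mem_cell h.1 y
    rw [sqDist_eq_of_mem_cell hp hyp]
    have := three_le_of_mem_cell hb hgap hp hy.1 hy.2 hyp
    exact sqDist_le (hmem p hp (by linarith)) y
  linarith

lemma IsMinimizer.le_of_replace (h : IsMinimizer (levelLaw 1 ρ) α) (hρ : IsFar ρ)
    (hd : IsServedRight ρ α) (γ : Finset ℝ) (hγ : γ.Nonempty)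
    (hcard : γ.card ≤ (α.filter (· ≤ 4)).card) :
    ∃ β : Finset ℝ, γ ⊆ β ∧ ∫ y, sqDist α y ∂tailLaw + ∫ y, sqDist α y ∂blockLaw ≤
      ∫ y, sqDist β y ∂tailLaw + ∫ y, sqDist β y ∂blockLaw := by
  classical
  have hc := card_filter_le_add α 4
  have opt := h.level_le zero_le_one hρ (γ ∪ α.filter (4 < ·))
    (hγ.mono Finset.subset_union_left) ((Finset.card_union_le _ _).trans (by omega))
  have oR := integral_far_sqDist_le h.1 hρ hd (β := γ ∪ α.filter (4 < ·))
    fun p hp hp4 => Finset.mem_union_right _ (Finset.mem_filter.2 ⟨hp, hp4⟩)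
  exact ⟨_, Finset.subset_union_left, by linarith⟩

lemma IsMinimizer.le_of_three (h : IsMinimizer (levelLaw 1 ρ) α) (hρ : IsFar ρ)
    (hd : IsServedRight ρ α) (h3 : 3 ≤ (α.filter (· ≤ 4)).card) :
    ∫ y, sqDist α y ∂tailLaw + ∫ y, sqDist α y ∂blockLaw ≤ 496 / 3577 := by
  obtain ⟨β, hβ, hle⟩ := h.le_of_replace hρ hd {4 / 7, 12 / 7, 24 / 7} (by simp)
    (Finset.card_le_three.trans h3)
  have oT := integral_sqDist_tailLaw_le_two (β := β) (hβ (by simp)) (hβ (by simp))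
  have oJ := integral_sqDist_blockLaw_le (β := β) (hβ (by simp))
  linarith

lemma IsMinimizer.le_of_two (h : IsMinimizer (levelLaw 1 ρ) α) (hρ : IsFar ρ)
    (hd : IsServedRight ρ α) (h2 : 2 ≤ (α.filter (· ≤ 4)).card) :
    ∫ y, sqDist α y ∂tailLaw + ∫ y, sqDist α y ∂blockLaw ≤ 1664 / 3577 := by
  obtain ⟨β, hβ, hle⟩ := h.le_of_replace hρ hd {8 / 7, 24 / 7} (by simp)
    (Finset.card_le_two.trans h2)
  have oT := integral_sqDist_tailLaw_le_one (β := β) (hβ (by simp))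
  have oJ := integral_sqDist_blockLaw_le (β := β) (hβ (by simp))
  linarith

lemma IsMinimizer.tail_centroid (h : IsMinimizer (levelLaw 1 ρ) α) (hρ : IsFar ρ)
    (hd : IsServedRight ρ α) (hb : ∃ p ∈ α, 3 ≤ p ∧ p ≤ 4) (hgap : ∀ p ∈ α, p ≤ 2 ∨ 3 ≤ p)
    {c : ℝ} (hc : c ∈ α) (hc2 : c ≤ 2) :
    ∫ y, (cell α c).indicator (fun y => y - c) y ∂tailLaw = 0 := by
  have L := h.level_centroid zero_le_one hρ hc
  rw [integral_far_cell_eq_zero hd hc (by linarith)] at L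
  have : ∫ y, (cell α c).indicator (fun y => y - c) y ∂blockLaw = 0 := by
    refine integral_eq_zero_of_ae (ae_blockLaw.mono fun y hy => ?_)
    refine Set.indicator_of_notMem (fun hyc => ?_) _
    have := three_le_of_mem_cell hb hgap hc hy.1 hy.2 hyc
    linarith
  rw [this] at L
  linarith

/-- A minimizer with a single point in the tail, in its lower half, and a single point in the block
has a large error there. -/
lemma IsMinimizer.lt_of_single (h : IsMinimizer (levelLaw 1 ρ) α) (hρ : IsFar ρ)
    (hd : IsServedRight ρ α) {b c : ℝ} (hbα : b ∈ α) (hb3 : 3 ≤ b) (hb4 : b ≤ 4) (hcα : c ∈ α)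
    (hc0 : 0 ≤ c) (hc1 : c ≤ 1) (hα : ∀ p ∈ α, p = c ∨ p = b ∨ 6 ≤ p) :
    1664 / 3577 < ∫ y, sqDist α y ∂tailLaw + ∫ y, sqDist α y ∂blockLaw := by
  have hgap : ∀ p ∈ α, p ≤ 2 ∨ 3 ≤ p := fun p hp => by
    rcases hα p hp with h | h | h
    · left; linarith
    · right; linarith
    · right; linarith
  have hJb : ∀ y, 3 ≤ y → y ≤ 4 → y ∈ cell α b := by
    intro y hy3 hy4
    obtain ⟨p, hp, hyp⟩ := exists_mem_cell h.1 y
    have h3 := three_le_of_mem_cell ⟨b, hbα, hb3, hb4⟩ hgap hp hy3 hy4 hyp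
    rcases hα p hp with e | e | e
    · linarith
    · exact e ▸ hyp
    · have h1 := (hyp b hbα).1
      have h2 : |y - b| ≤ 1 := abs_le.2 ⟨by linarith, by linarith⟩
      rw [abs_of_neg (by linarith)] at h1
      linarith
  have Lc := h.tail_centroid hρ hd ⟨b, hbα, hb3, hb4⟩ hgap hcα (by linarith)
  have Lb := h.level_centroid zero_le_one hρ hbα
  rw [integral_far_cell_eq_zero hd hbα hb4] at Lb
  have tb := isTame_cell α b
  have tc := isTame_cell α c
  have LJ : 24 / 7 - b ≤ ∫ y, (cell α b).indicator (fun y => y - b) y ∂blockLaw := by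
    have := le_integral_blockLaw (tb _ isBounded_blockLaw) (3 - b) 1 0 fun z h0 h1 => by
      rw [Set.indicator_of_mem (hJb _ (by linarith) (by linarith))]
      linarith
    linarith
  have LJ' : ∫ y, (cell α b).indicator (fun y => y - b) y ∂blockLaw ≤ 24 / 7 - b := by
    have := integral_blockLaw_le (tb _ isBounded_blockLaw) (3 - b) 1 0 fun z h0 h1 => by
      rw [Set.indicator_of_mem (hJb _ (by linarith) (by linarith))]
      linarith
    linarith
  have cJ := le_integral_blockLaw (isTame_sqDist α _ isBounded_blockLaw)
    ((3 - b) ^ 2) (2 * (3 - b)) 1 fun z h0 h1 => by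
      rw [sqDist_eq_of_mem_cell hbα (hJb _ (by linarith) (by linarith))]
      linarith
  have LTb : ∫ y, (cell α b).indicator (fun y => y - b) y ∂tailLaw = -(24 / 7 - b) := by
    linarith
  have tt : IsTame fun y => sqDist α y +
      (-(24 / 7 - b) * (cell α b).indicator (fun y => y - b) y +
        (c - 4 / 7) * (cell α c).indicator (fun y => y - c) y) :=
    (isTame_sqDist α).add ((tb.const_mul _).add (tc.const_mul _))
  -- The integrand becomes (y - c)(y - 4/7) on the cell of c and (b - y)(24/7 - y) on that of b. The
  -- multiplier of b produces (24/7 - b)², which cancels the excess of the block error over its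
  -- variance. As 4/7 is the mean of the lower half of the tail, c drops out of the bound there.
  have key := le_integral_tailLaw_split (tt _ isBounded_tailLaw) (13 / 28) (5 / 7) (1 / 4)
    (4 / 7 * c) (-(c / 2 + 2 / 7)) (1 / 4) (fun z h0 h1 => ?_) (fun t h0 h2 => ?_)
  · rw [integral_add (isTame_sqDist _ _ isBounded_tailLaw)
      ((tb.const_mul _).add (tc.const_mul _) _ isBounded_tailLaw),
      integral_add (tb.const_mul _ _ isBounded_tailLaw) (tc.const_mul _ _ isBounded_tailLaw),
      integral_const_mul, integral_const_mul, Lc, LTb] at key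
    nlinarith
  · obtain ⟨p, hp, hyp⟩ := exists_mem_cell h.1 ((3 + z) / 2)
    rw [sqDist_eq_of_mem_cell hp hyp]
    rcases hα p hp with rfl | rfl | hp6
    · rw [Set.indicator_of_mem hyp, Set.indicator_of_notMem fun hb => by
        have := cell_unique hp hbα hyp hb
        linarith]
      nlinarith
    · rw [Set.indicator_of_mem hyp, Set.indicator_of_notMem fun hc => by
        have := cell_unique hp hcα hyp hc
        linarith]
      have : (3 - (3 + z) / 2) * (24 / 7 - (3 + z) / 2) ≤
          (p - (3 + z) / 2) * (24 / 7 - (3 + z) / 2) :=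
        mul_le_mul_of_nonneg_right (by linarith) (by linarith)
      nlinarith
    · have h1 := (hyp b hbα).1
      rw [abs_of_neg (by linarith), abs_of_neg (by linarith)] at h1
      linarith
  · obtain ⟨p, hp, hyp⟩ := exists_mem_cell h.1 (t / 2)
    have hpc : p = c := by
      rcases hα p hp with e | e
      · exact e
      · have h1 := (hyp c hcα).1
        have h2 : |t / 2 - c| ≤ 1 := abs_le.2 ⟨by linarith, by linarith⟩
        have hp3 : 3 ≤ p := by rcases e with e | e <;> linarith
        rw [abs_of_neg (by linarith)] at h1
        linarith
    subst hpc
    rw [sqDist_eq_of_mem_cell hp hyp, Set.indicator_of_mem hyp, Set.indicator_of_notMem fun hb => by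
      have := cell_unique hp hbα hyp hb
      linarith]
    exact le_of_eq (by ring)

/-- Without such a point the upper half of the tail, y = (3 + z)/2, is at distance at least (1 +
z)/2 from α. That is too costly if α has two points up to 2 or three up to 4. Otherwise exactly two
points lie up to 4, and either one serves the tail from [0, 1], excluded by
`IsMinimizer.lt_of_single`, or both are at least 3. -/
theorem IsMinimizer.exists_mem_upper_tail (h : IsMinimizer (levelLaw 1 ρ) α) (hρ : IsFar ρ)
    (hd : IsServedRight ρ α) (hb : ∃ p ∈ α, 3 ≤ p ∧ p ≤ 4) (hgap : ∀ p ∈ α, p ≤ 2 ∨ 3 ≤ p)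
    (hgap' : ∀ p ∈ α, p ≤ 4 ∨ 6 ≤ p)
    (h2 : ∃ p ∈ α, ∃ q ∈ α, p ≠ q ∧ 0 ≤ p ∧ p ≤ 4 ∧ 0 ≤ q ∧ q ≤ 4) :
    ∃ p ∈ α, 1 < p ∧ p ≤ 2 := by
  classical
  by_contra! hno
  have hlow : ∀ p ∈ α, p ≤ 1 ∨ 3 ≤ p := fun p hp => by
    rcases hgap p hp with hp2 | hp3
    · left
      by_contra! h1
      linarith [hno p hp h1]
    · exact Or.inr hp3
  have cT := le_integral_tailLaw_split (isTame_sqDist α _ isBounded_tailLaw)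
    (1 / 4) (1 / 2) (1 / 4) 0 0 0 (fun z h0 h1 => by
      refine le_sqDist h.1 fun p hp => ?_
      rcases hlow p hp with hp1 | hp3 <;> nlinarith) fun t _ _ => by
      have := sqDist_nonneg α (t / 2)
      linarith
  have cJ := integral_sqDist_nonneg blockLaw α
  obtain ⟨p, hp, q, hq, hpq, hp0, hp4, hq0, hq4⟩ := h2
  have hpq4 : ({p, q} : Finset ℝ) ⊆ α.filter (· ≤ 4) := by
    refine Finset.insert_subset (Finset.mem_filter.2 ⟨hp, hp4⟩) ?_
    rw [Finset.singleton_subset_iff]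
    exact Finset.mem_filter.2 ⟨hq, hq4⟩
  have hm2 : 2 ≤ (α.filter (· ≤ 4)).card := 
    (Finset.card_pair hpq).ge.trans (Finset.card_le_card hpq4)
  by_cases hn2 : 2 ≤ (α.filter (· ≤ 2)).card
  · have := h.tail_le_of_two hρ hd hb hgap hn2
    norm_num at cT
    linarith
  by_cases hm3 : 3 ≤ (α.filter (· ≤ 4)).card
  · have := h.le_of_three hρ hd hm3
    norm_num at cT
    linarith
  have hle := h.le_of_two hρ hd hm2
  have heq : α.filter (· ≤ 4) = {p, q} :=
    (Finset.eq_of_subset_of_card_le hpq4 (by rw [Finset.card_pair hpq]; omega)).symm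
  have hα : ∀ x ∈ α, x = p ∨ x = q ∨ 6 ≤ x := fun x hx => by
    rcases hgap' x hx with h4 | h6
    · have : x ∈ α.filter (· ≤ 4) := Finset.mem_filter.2 ⟨hx, h4⟩
      rw [heq, Finset.mem_insert, Finset.mem_singleton] at this
      tauto
    · exact Or.inr (Or.inr h6)
  rcases hlow p hp with hp1 | hp3 <;> rcases hlow q hq with hq1 | hq3
  · refine hn2 ?_
    rw [← Finset.card_pair hpq]
    refine Finset.card_le_card (Finset.insert_subset (Finset.mem_filter.2 ⟨hp, by linarith⟩) ?_)
    rw [Finset.singleton_subset_iff]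
    exact Finset.mem_filter.2 ⟨hq, by linarith⟩
  · have := h.lt_of_single hρ hd hq hq3 hq4 hp hp0 hp1 hα
    linarith
  · have := h.lt_of_single hρ hd hp hp3 hp4 hq hq0 hq1 fun x hx => by
      have := hα x hx
      tauto
    linarith
  · have cT' := le_integral_tailLaw (isTame_sqDist α _ isBounded_tailLaw) 9 (-6) 1
      fun t h0 h2 => le_sqDist h.1 fun x hx => by
        have hx3 : 3 ≤ x := by rcases hα x hx with e | e | e <;> linarith
        nlinarith
    norm_num at cT'
    linarith

/-- Z stands for the image of the next union of basic intervals, of which only the first, [3/2, 2],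
matters. If α misses Z, the largest point c up to 2 lies in (1, 3/2), too far to the left. Either
there is a second point up to 2, or the two given points lie in the block and c serves the tail from
the left alone. -/
theorem IsMinimizer.exists_mem_tail (h : IsMinimizer (levelLaw 1 ρ) α) (hρ : IsFar ρ)
    (hd : IsServedRight ρ α) (hb : ∃ p ∈ α, 3 ≤ p ∧ p ≤ 4) (hgap : ∀ p ∈ α, p ≤ 2 ∨ 3 ≤ p)
    (hu : ∃ p ∈ α, 1 < p ∧ p ≤ 2) {Z : Set ℝ} (hZ : Set.Icc (3 / 2) 2 ⊆ Z)
    (h2 : ∃ p ∈ α, ∃ q ∈ α, p ≠ q ∧ (p ∈ Z ∨ 3 ≤ p ∧ p ≤ 4) ∧ (q ∈ Z ∨ 3 ≤ q ∧ q ≤ 4)) :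
    ∃ p ∈ α, p ∈ Z := by
  classical
  by_contra! hno
  have hlow : ∀ p ∈ α, p ≤ 2 → p < 3 / 2 := fun p hp hp2 => by
    by_contra! h1
    exact hno p hp (hZ ⟨h1, hp2⟩)
  obtain ⟨c₀, hc₀, hc₀1, hc₀2⟩ := hu
  obtain ⟨c, hc, hmax⟩ := Finset.exists_max_image (α.filter (· ≤ 2)) id
    ⟨c₀, Finset.mem_filter.2 ⟨hc₀, hc₀2⟩⟩
  rw [Finset.mem_filter] at hc
  obtain ⟨hcα, hc2⟩ := hc
  have hmax' : ∀ p ∈ α, p ≤ 2 → p ≤ c := fun p hp hp2 =>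
    hmax p (Finset.mem_filter.2 ⟨hp, hp2⟩)
  have hc1 : 1 < c := lt_of_lt_of_le hc₀1 (hmax' _ hc₀ hc₀2)
  have hc32 := hlow c hcα hc2
  by_cases hn2 : 2 ≤ (α.filter (· ≤ 2)).card
  · have hle := h.tail_le_of_two hρ hd hb hgap hn2
    have Lc := h.tail_centroid hρ hd hb hgap hcα hc2
    have tc := isTame_cell α c
    -- The multiplier c - 1 gives (y - c)(y - 1), nonnegative on [0, 1] and at least z (1 + z)/4 at
    -- y = (3 + z)/2.
    have key := le_integral_tailLaw_split
      (((isTame_sqDist α).add (tc.const_mul (c - 1))) _ isBounded_tailLaw)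
      0 (1 / 4) (1 / 4) 0 0 0 (fun z h0 h1 => ?_) (fun t h0 h2 => ?_)
    · rw [integral_add (isTame_sqDist _ _ isBounded_tailLaw)
        (tc.const_mul _ _ isBounded_tailLaw), integral_const_mul, Lc] at key
      norm_num at key
      linarith
    · obtain ⟨p, hp, hyp⟩ := exists_mem_cell h.1 ((3 + z) / 2)
      rw [sqDist_eq_of_mem_cell hp hyp]
      rcases hgap p hp with hp2 | hp3
      · have hpc : p = c := by
          refine le_antisymm (hmax' p hp hp2) ?_
          have := (hyp c hcα).1
          have h3 := hlow p hp hp2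
          rw [abs_of_pos (by linarith), abs_of_pos (by linarith)] at this
          linarith
        subst hpc
        rw [Set.indicator_of_mem hyp]
        nlinarith [mul_nonneg (by linarith : (0 : ℝ) ≤ 3 / 2 - p) (by linarith : 0 ≤ 1 / 2 + z / 2)]
      · rw [Set.indicator_of_notMem fun hyc => by
          have := cell_unique hp hcα hyp hyc
          linarith]
        nlinarith
    · by_cases hyc : t / 2 ∈ cell α c
      · rw [Set.indicator_of_mem hyc, sqDist_eq_of_mem_cell hcα hyc]
        nlinarith
      · rw [Set.indicator_of_notMem hyc]
        have := sqDist_nonneg α (t / 2)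
        linarith
  · obtain ⟨p, hp, q, hq, hpq, hpZ, hqZ⟩ := h2
    have hp' := hpZ.resolve_left (hno p hp)
    have hq' := hqZ.resolve_left (hno q hq)
    have hm3 : 3 ≤ (α.filter (· ≤ 4)).card := by
      have : ({c, p, q} : Finset ℝ) ⊆ α.filter (· ≤ 4) := by
        intro x hx
        simp only [Finset.mem_insert, Finset.mem_singleton] at hx
        rcases hx with rfl | rfl | rfl
        · exact Finset.mem_filter.2 ⟨hcα, by linarith⟩
        · exact Finset.mem_filter.2 ⟨hp, hp'.2⟩
        · exact Finset.mem_filter.2 ⟨hq, hq'.2⟩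
      have hcard := Finset.card_le_card this
      rwa [Finset.card_eq_three.2 ⟨c, p, q, by linarith [hp'.1], by linarith [hq'.1], hpq, rfl⟩]
        at hcard
    have hle := h.le_of_three hρ hd hm3
    have hα : ∀ x ∈ α, x = c ∨ 3 ≤ x := fun x hx => by
      rcases hgap x hx with hx2 | hx3
      · left
        exact Finset.card_le_one.1 (by omega : (α.filter (· ≤ 2)).card ≤ 1) x
          (Finset.mem_filter.2 ⟨hx, hx2⟩) c (Finset.mem_filter.2 ⟨hcα, hc2⟩)
      · exact Or.inr hx3
    have cJ := integral_sqDist_nonneg blockLaw α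
    -- Since 1 < c < 3/2, the distance to α is at least z/2 on the upper half and 1 - t/2 on the
    -- lower one.
    have cT := le_integral_tailLaw_split (isTame_sqDist α _ isBounded_tailLaw)
      0 0 (1 / 4) 1 (-1) (1 / 4)
      (fun z h0 h1 => le_sqDist h.1 fun x hx => by
        rcases hα x hx with rfl | hx3 <;> nlinarith)
      (fun t h0 h2 => le_sqDist h.1 fun x hx => by
        rcases hα x hx with rfl | hx3 <;> nlinarith)
    norm_num at cT
    linarith

/-- Strictness at 4 is needed for the Voronoi claim: with a block point only at 4, the point 3 would
be equidistant from it and from a tail point at 2. If 4 were the only block point, moving it to 24/7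
would lower the error. -/
theorem IsMinimizer.exists_mem_block_lt (h : IsMinimizer (levelLaw 1 ρ) α) (hρ : IsFar ρ)
    (hd : IsServedRight ρ α) (hb : ∃ p ∈ α, 3 ≤ p ∧ p ≤ 4) (hgap : ∀ p ∈ α, p ≤ 2 ∨ 3 ≤ p) :
    ∃ p ∈ α, 3 ≤ p ∧ p < 4 := by
  classical
  by_contra! hno
  have h4 : (4 : ℝ) ∈ α := by
    obtain ⟨b, hb, hb3, hb4⟩ := hb
    have := le_antisymm hb4 (hno b hb hb3)
    exact this ▸ hb
  have hcard : (insert (24 / 7) (α.erase 4)).card ≤ α.card := by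
    have h1 := Finset.card_insert_le (24 / 7) (α.erase 4)
    have h2 := Finset.card_pos.2 ⟨_, h4⟩
    rw [Finset.card_erase_of_mem h4] at h1
    omega
  have hmem : ∀ p ∈ α, p ≠ 4 → p ∈ insert (24 / 7) (α.erase 4) := fun p hp h1 =>
    Finset.mem_insert_of_mem (Finset.mem_erase.2 ⟨h1, hp⟩)
  have opt := h.level_le zero_le_one hρ _ ⟨_, Finset.mem_insert_self (24 / 7) (α.erase 4)⟩ hcard
  have oR := integral_far_sqDist_le h.1 hρ hd (β := insert (24 / 7) (α.erase 4))
    fun p hp hp4 => hmem p hp (by linarith)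
  have oJ := integral_sqDist_blockLaw_le (Finset.mem_insert_self (24 / 7) (α.erase 4))
  have oT : ∫ y, sqDist (insert (24 / 7) (α.erase 4)) y ∂tailLaw ≤
      ∫ y, sqDist α y ∂tailLaw := by
    refine integral_mono_ae (isTame_sqDist _ _ isBounded_tailLaw)
      (isTame_sqDist _ _ isBounded_tailLaw) (ae_tailLaw.mono fun y hy => ?_)
    refine le_sqDist h.1 fun p hp => ?_
    by_cases hp4 : p = 4
    · subst hp4
      refine (sqDist_le (Finset.mem_insert_self _ _) y).trans ?_
      nlinarith [hy.2]
    · exact sqDist_le (hmem p hp hp4) y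
  have cJ := le_integral_blockLaw (isTame_sqDist α _ isBounded_blockLaw) 1 (-2) 1
    fun z h0 h1 => by
      obtain ⟨p, hp, hyp⟩ := exists_mem_cell h.1 (3 + z)
      rw [sqDist_eq_of_mem_cell hp hyp]
      have := hno p hp (three_le_of_mem_cell hb hgap hp (by linarith) (by linarith) hyp)
      nlinarith
  norm_num at cJ
  linarith

end

/-! ### Passage between the scales -/

/-- The coordinate in which the basic interval with index `k + 1` becomes `[3, 4]`. -/
noncomputable def levelMap (k : ℕ) (x : ℝ) : ℝ := 2 ^ (k + 2) * (1 - x)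

lemma levelMap_succ (k : ℕ) (x : ℝ) : levelMap (k + 1) x = 2 * levelMap k x := by
  unfold levelMap; ring

lemma levelMap_add (k j : ℕ) (x : ℝ) : levelMap (k + j) x = 2 ^ j * levelMap k x := by
  unfold levelMap; ring

lemma measurable_levelMap (k : ℕ) : Measurable (levelMap k) := by
  unfold levelMap; fun_prop

lemma levelMap_injective (k : ℕ) : Function.Injective (levelMap k) := by
  intro x y h
  have h2 : (2 : ℝ) ^ (k + 2) ≠ 0 := by positivity
  have := mul_left_cancel₀ h2 h
  linarith

lemma mem_J_iff (k : ℕ) (x : ℝ) : x ∈ J (k + 1) ↔ 3 ≤ levelMap k x ∧ levelMap k x ≤ 4 := by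
  have hp : (0 : ℝ) < 2 ^ k := by positivity
  constructor
  · rintro ⟨t, ⟨h0, h1⟩, rfl⟩
    have : levelMap k (S (k + 1) t) = 4 - t := by
      simp only [levelMap, S, Nat.add_sub_cancel, pow_succ]
      field_simp
      ring
    rw [this]
    constructor <;> linarith
  · rintro ⟨h3, h4⟩
    refine ⟨4 - levelMap k x, ⟨by linarith, by linarith⟩, ?_⟩
    simp only [levelMap, S, Nat.add_sub_cancel, pow_succ]
    field_simp
    ring

lemma levelMap_of_mem_JTail {k : ℕ} {x : ℝ} (hx : x ∈ JTail k) :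
    0 ≤ levelMap k x ∧ levelMap k x ≤ 4 := by
  obtain ⟨j, hj⟩ := Set.mem_iUnion.1 hx
  rw [← add_assoc, mem_J_iff, levelMap_add] at hj
  have h1 : (1 : ℝ) ≤ 2 ^ j := one_le_pow₀ (by norm_num)
  have h0 : 0 ≤ levelMap k x := by
    by_contra! hneg
    nlinarith
  exact ⟨h0, by nlinarith⟩

lemma levelMap_of_mem_JTail_succ {k : ℕ} {x : ℝ} (hx : x ∈ JTail (k + 1)) :
    0 ≤ levelMap k x ∧ levelMap k x ≤ 2 := by
  have := levelMap_of_mem_JTail hx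
  rw [levelMap_succ] at this
  constructor <;> linarith [this.1, this.2]

lemma mem_JTail_or {k : ℕ} {x : ℝ} (hx : x ∈ JTail k) : x ∈ J (k + 1) ∨ x ∈ JTail (k + 1) := by
  obtain ⟨j, hj⟩ := Set.mem_iUnion.1 hx
  cases j with
  | zero => exact Or.inl hj
  | succ j =>
    refine Or.inr (Set.mem_iUnion.2 ⟨j, ?_⟩)
    rwa [show k + 1 + (j + 1) = k + (j + 1 + 1) by ring]

lemma Icc_subset_levelMap_image (k : ℕ) : Set.Icc (3 / 2) 2 ⊆ levelMap k '' JTail (k + 1) := by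
  rintro y ⟨h1, h2⟩
  have e : levelMap k (1 - y / 2 ^ (k + 2)) = y := by
    unfold levelMap; field_simp; ring
  refine ⟨1 - y / 2 ^ (k + 2), Set.mem_iUnion.2 ⟨0, ?_⟩, e⟩
  rw [zero_add, mem_J_iff, levelMap_succ, e]
  constructor <;> linarith

lemma map_two_mul_tailLaw : tailLaw.map (fun y => 2 * y) =
    ENNReal.ofReal (1 / 2) • blockLaw + ENNReal.ofReal (1 / 2) • tailLaw := by
  conv_lhs => rw [tailLaw_eq]
  rw [Measure.map_add _ _ (by fun_prop), Measure.map_smul, Measure.map_smul,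
    Measure.map_map (by fun_prop) (by fun_prop), Measure.map_map (by fun_prop) (by fun_prop),
    blockLaw]
  congr 2
  · congr 1; funext y; simp only [Function.comp]; ring
  · conv_rhs => rw [← Measure.map_id (μ := tailLaw)]
    congr 1; funext y; simp only [Function.comp, id]; ring

lemma map_four_mul_reflLaw : reflLaw.map (fun y => 4 * y) =
    ENNReal.ofReal (1 / 4) • blockLaw + ENNReal.ofReal (3 / 4) • tailLaw := by
  conv_lhs => rw [reflLaw_eq]
  rw [Measure.map_add _ _ (by fun_prop), Measure.map_smul, Measure.map_smul,
    Measure.map_map (by fun_prop) (by fun_prop), Measure.map_map (by fun_prop) (by fun_prop),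
    blockLaw]
  congr 2
  · congr 1; funext y; simp only [Function.comp]; ring
  · conv_rhs => rw [← Measure.map_id (μ := tailLaw)]
    congr 1; funext y; simp only [Function.comp, id]; ring

/-- The tail has mass 3/4 and J_1 has mass 1/4. The factor 4/3 normalizes the tail, whence θ = 1/3.
-/
lemma levelLaw_zero : ENNReal.ofReal (4 / 3) • P.map (levelMap 0) = levelLaw (1 / 3) 0 := by
  have : P.map (levelMap 0) = reflLaw.map fun y => 4 * y := by
    rw [reflLaw, Measure.map_map (by fun_prop) (by fun_prop)]
    congr 1
    funext x
    simp only [levelMap, Function.comp]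
    norm_num
  rw [this, map_four_mul_reflLaw, smul_add, smul_smul, smul_smul,
    ← ENNReal.ofReal_mul (by norm_num), ← ENNReal.ofReal_mul (by norm_num), levelLaw, add_zero,
    add_comm]
  norm_num

/-- Doubling splits the tail into a new block and a new tail of mass 1/2 each, so θ becomes 1
whatever it was. The old block moves to [6, 8] and joins the far part. -/
lemma levelLaw_succ (θ : ℝ) {ρ : Measure ℝ} (hρ : IsFar ρ) :
    ∃ ρ', IsFar ρ' ∧ ENNReal.ofReal 2 • (levelLaw θ ρ).map (fun y => 2 * y) = levelLaw 1 ρ' := by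
  refine ⟨ENNReal.ofReal 2 • (ENNReal.ofReal θ • blockLaw + ρ).map fun y => 2 * y, ⟨?_, ?_⟩, ?_⟩
  · have h1 := hρ.1
    have h2 : IsFiniteMeasure (ENNReal.ofReal θ • blockLaw) := Measure.smul_finite _ (by simp)
    exact Measure.smul_finite _ (by simp)
  · obtain ⟨b, hb⟩ := hρ.2
    refine ⟨max 8 (2 * b), Measure.ae_smul_measure ?_ _⟩
    rw [ae_map_iff (by fun_prop) measurableSet_Icc, ae_add_measure_iff]
    refine ⟨Measure.ae_smul_measure ?_ _, ?_⟩
    · filter_upwards [ae_blockLaw] with y hy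
      exact ⟨by linarith [hy.1], le_max_of_le_left (by linarith [hy.2])⟩
    · filter_upwards [hb] with y hy
      exact ⟨by linarith [hy.1], le_max_of_le_right (by linarith [hy.2])⟩
  · rw [levelLaw, add_assoc, Measure.map_add _ _ (by fun_prop), map_two_mul_tailLaw, smul_add,
      smul_add, smul_smul, smul_smul, ← ENNReal.ofReal_mul (by norm_num), levelLaw]
    norm_num [add_comm]

lemma exists_levelLaw_eq (k : ℕ) : ∃ c : ℝ, 0 < c ∧ ∃ ρ, IsFar ρ ∧ (k = 0 → ρ = 0) ∧
    ENNReal.ofReal c • P.map (levelMap k) = levelLaw (if k = 0 then 1 / 3 else 1) ρ := by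
  induction k with
  | zero => exact ⟨4 / 3, by norm_num, 0, isFar_zero, fun _ => rfl, by simpa using levelLaw_zero⟩
  | succ k ih =>
    obtain ⟨c, hc, ρ, hρ, -, e⟩ := ih
    obtain ⟨ρ', hρ', e'⟩ := levelLaw_succ (if k = 0 then 1 / 3 else 1) hρ
    refine ⟨2 * c, by positivity, ρ', hρ', fun h => absurd h k.succ_ne_zero, ?_⟩
    rw [if_neg k.succ_ne_zero, ← e', ← e, Measure.map_smul, smul_smul,
      Measure.map_map (by fun_prop) (measurable_levelMap k), ENNReal.ofReal_mul (by norm_num)]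
    congr 2
    funext x
    exact levelMap_succ k x

/-! ### From optimal sets of n-means to minimizers at each level -/

lemma isBounded_P : IsBounded P := by
  refine ⟨inferInstance, 0, 1, ?_⟩
  have h := ae_reflLaw
  rw [reflLaw, ae_map_iff (by fun_prop) measurableSet_Icc] at h
  filter_upwards [h] with x hx
  constructor <;> linarith [hx.1, hx.2]

lemma distortion_eq {α : Finset ℝ} (hα : α.Nonempty) :
    distortion P α = ENNReal.ofReal (∫ x, sqDist α x ∂P) := by
  rw [ofReal_integral_eq_lintegral_ofReal (isTame_sqDist α _ isBounded_P)
    (ae_of_all _ (sqDist_nonneg α)), distortion]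
  refine lintegral_congr fun x => le_antisymm ?_ ?_
  · obtain ⟨a, ha, e⟩ := exists_sqDist_eq hα x
    exact e ▸ iInf₂_le a ha
  · exact le_iInf₂ fun a ha => ENNReal.ofReal_le_ofReal (sqDist_le ha x)

lemma IsOptimalSet.isMinimizer {n : ℕ} {α : Finset ℝ} (h : IsOptimalSet P n α) :
    IsMinimizer P α := by
  have hα : α.Nonempty := Finset.card_pos.1 h.1.1
  refine ⟨hα, fun β hβ hcard => ?_⟩
  rw [← ENNReal.ofReal_le_ofReal_iff (integral_sqDist_nonneg P β), ← distortion_eq hα,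
    ← distortion_eq hβ, h.2]
  exact iInf₂_le β ⟨Finset.card_pos.2 hβ, hcard.trans h.1.2⟩

lemma sqDist_image_levelMap (k : ℕ) {α : Finset ℝ} (hα : α.Nonempty) (x : ℝ) :
    sqDist (α.image (levelMap k)) (levelMap k x) = (2 ^ (k + 2)) ^ 2 * sqDist α x := by
  have e : ∀ a, (levelMap k x - levelMap k a) ^ 2 = (2 ^ (k + 2)) ^ 2 * (x - a) ^ 2 := fun a => by
    unfold levelMap; ring
  refine le_antisymm ?_ ?_
  · obtain ⟨a, ha, h⟩ := exists_sqDist_eq hα x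
    rw [h, ← e]
    exact sqDist_le (Finset.mem_image_of_mem _ ha) _
  · refine le_sqDist (hα.image _) fun b hb => ?_
    obtain ⟨a, ha, rfl⟩ := Finset.mem_image.1 hb
    rw [e]
    exact mul_le_mul_of_nonneg_left (sqDist_le ha x) (by positivity)

lemma IsMinimizer.levelMap {α : Finset ℝ} (h : IsMinimizer P α) (k : ℕ) {c : ℝ} (hc : 0 < c) :
    IsMinimizer (ENNReal.ofReal c • P.map (levelMap k)) (α.image (levelMap k)) := by
  have e : ∀ β : Finset ℝ, β.Nonempty → ∫ y, sqDist (β.image (InfQuant.levelMap k)) y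
      ∂(ENNReal.ofReal c • P.map (InfQuant.levelMap k)) =
      c * ((2 ^ (k + 2)) ^ 2 * ∫ x, sqDist β x ∂P) := by
    intro β hβ
    rw [integral_ofReal_smul _ _ hc.le, integral_map (measurable_levelMap k).aemeasurable
      (continuous_sqDist _).aestronglyMeasurable]
    simp_rw [sqDist_image_levelMap k hβ]
    rw [integral_const_mul]
  refine ⟨h.1.image _, fun β hβ hcard => ?_⟩
  set γ := β.image fun y => 1 - y / 2 ^ (k + 2) with hγ
  have hβγ : β = γ.image (InfQuant.levelMap k) := by
    rw [hγ, Finset.image_image]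
    have : (InfQuant.levelMap k ∘ fun y => 1 - y / 2 ^ (k + 2)) = id := by
      funext y
      simp only [Function.comp, InfQuant.levelMap, id]
      field_simp
      ring
    rw [this, Finset.image_id]
  have hγ0 : γ.Nonempty := hβ.image _
  rw [hβγ, e α h.1, e γ hγ0]
  have := h.2 γ hγ0 (Finset.card_image_le.trans (hcard.trans Finset.card_image_le))
  gcongr

/-! ### Location of the points of an optimal set, level by level -/

section
variable {α : Finset ℝ}

/-- Two points of `α` have coordinate at most `2` at level `k`. -/
def HasPair (α : Finset ℝ) (k : ℕ) : Prop :=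
  ∃ x ∈ α, ∃ y ∈ α, x ≠ y ∧ levelMap k x ≤ 2 ∧ levelMap k y ≤ 2

lemma HasPair.of_succ {k : ℕ} (h : HasPair α (k + 1)) : HasPair α k := by
  obtain ⟨x, hx, y, hy, hxy, h1, h2⟩ := h
  rw [levelMap_succ] at h1 h2
  exact ⟨x, hx, y, hy, hxy, by linarith, by linarith⟩

end

section
variable {α : Finset ℝ}

lemma HasPair.two_le_card {k : ℕ} (h : HasPair α k) :
    2 ≤ ((α.image (levelMap k)).filter (· ≤ 2)).card := by
  obtain ⟨x, hx, y, hy, hxy, h1, h2⟩ := h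
  rw [← Finset.card_pair ((levelMap_injective k).ne hxy)]
  refine Finset.card_le_card (Finset.insert_subset
    (Finset.mem_filter.2 ⟨Finset.mem_image_of_mem _ hx, h1⟩) ?_)
  rw [Finset.singleton_subset_iff]
  exact Finset.mem_filter.2 ⟨Finset.mem_image_of_mem _ hy, h2⟩

lemma IsMinimizer.exists_level (h : IsMinimizer P α) (k : ℕ) :
    ∃ ρ, IsFar ρ ∧ (k = 0 → ρ = 0) ∧
      IsMinimizer (levelLaw (if k = 0 then 1 / 3 else 1) ρ) (α.image (InfQuant.levelMap k)) := by
  obtain ⟨c, hc, ρ, hρ, h0, e⟩ := exists_levelLaw_eq k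
  exact ⟨ρ, hρ, h0, e ▸ h.levelMap k hc⟩

theorem HasPair.exists_mem_J {k : ℕ} (h2 : HasPair α k) (h : IsMinimizer P α) :
    ∃ x ∈ α, 3 ≤ levelMap k x ∧ levelMap k x ≤ 4 := by
  obtain ⟨ρ, hρ, h0, hm⟩ := h.exists_level k
  have key : ∃ p ∈ α.image (levelMap k), 3 ≤ p ∧ p ≤ 4 := by
    refine hm.exists_mem_block hρ ?_ h2.two_le_card
    -- At level 0 the far part is zero, so a point above 4 would have all the mass of its cell on
    -- its left.
    by_cases hk : k = 0
    · right
      refine ⟨if_pos hk, fun p hp => ?_⟩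
      by_contra! hp4
      refine hm.not_ae_lt hρ hp (ae_levelLaw (fun y _ _ _ => by linarith)
        (fun y _ _ _ => by linarith) ?_)
      rw [h0 hk]
      simp
    · exact Or.inl (if_neg hk)
  obtain ⟨p, hp, hp3, hp4⟩ := key
  obtain ⟨x, hx, rfl⟩ := Finset.mem_image.1 hp
  exact ⟨x, hx, hp3, hp4⟩

/-- At level `k`, the part of the measure to the right of the block is served from the right. -/
lemma isServedRight_levelMap (h : IsMinimizer P α) {k : ℕ}
    (h2 : k ≠ 0 → HasPair α (k - 1)) {ρ : Measure ℝ} (hρ : IsFar ρ) (h0 : k = 0 → ρ = 0) :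
    IsServedRight ρ (α.image (levelMap k)) := by
  cases k with
  | zero => rw [h0 rfl]; exact isServedRight_zero _
  | succ k =>
    obtain ⟨x, hx, h3, h4⟩ := (h2 k.succ_ne_zero).exists_mem_J h
    rw [Nat.add_sub_cancel] at h3 h4
    refine hρ.isServedRight (Finset.mem_image_of_mem _ hx) ?_ ?_ <;> rw [levelMap_succ] <;> linarith

/-- No point of an optimal set lies in the gap at level `k`. -/
theorem not_mem_gap_levelMap (h : IsMinimizer P α) {k : ℕ} (h2 : k ≠ 0 → HasPair α (k - 1))
    (hb : ∃ x ∈ α, 3 ≤ levelMap k x ∧ levelMap k x ≤ 4) {x : ℝ} (hx : x ∈ α) :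
    ¬ (2 < levelMap k x ∧ levelMap k x < 3) := by
  obtain ⟨ρ, hρ, h0, hm⟩ := h.exists_level k
  obtain ⟨b, hb, hb'⟩ := hb
  refine hm.not_mem_gap hρ ?_ ?_ ⟨_, Finset.mem_image_of_mem _ hb, hb'⟩
    (isServedRight_levelMap h h2 hρ h0) (Finset.mem_image_of_mem _ hx) <;>
  split_ifs <;> norm_num

/-- In the coordinate of level `k + 1`, a minimizer with two points in the tail of basic intervals
has a point in `[3, 4)`, a point in `(1, 2]`, a point in the next tail, and none in `(2, 3)`. -/
theorem IsMinimizer.levelMap_points (h : IsMinimizer P α) {k : ℕ} (hk : 1 ≤ k)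
    (h2 : ∃ x ∈ α, ∃ y ∈ α, x ≠ y ∧ x ∈ JTail k ∧ y ∈ JTail k) :
    (∃ x ∈ α, 3 ≤ InfQuant.levelMap k x ∧ InfQuant.levelMap k x < 4) ∧
    (∃ x ∈ α, 1 < InfQuant.levelMap k x ∧ InfQuant.levelMap k x ≤ 2) ∧
    (∃ x ∈ α, x ∈ JTail (k + 1)) ∧
    ∀ x ∈ α, ¬ (2 < InfQuant.levelMap k x ∧ InfQuant.levelMap k x < 3) := by
  obtain ⟨m, rfl⟩ : ∃ m, k = m + 1 := ⟨k - 1, by omega⟩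
  obtain ⟨x, hx, y, hy, hxy, hxJ, hyJ⟩ := h2
  have pair : HasPair α m := ⟨x, hx, y, hy, hxy, (levelMap_of_mem_JTail_succ hxJ).2,
    (levelMap_of_mem_JTail_succ hyJ).2⟩
  -- If neither given point lies in J_{k+1}, both lie in the next tail and form a pair at this
  -- level.
  have hb : ∃ x ∈ α, 3 ≤ InfQuant.levelMap (m + 1) x ∧ InfQuant.levelMap (m + 1) x ≤ 4 := by
    rcases mem_JTail_or hxJ with hx1 | hx1
    · exact ⟨x, hx, (mem_J_iff _ _).1 hx1⟩
    rcases mem_JTail_or hyJ with hy1 | hy1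
    · exact ⟨y, hy, (mem_J_iff _ _).1 hy1⟩
    exact HasPair.exists_mem_J ⟨x, hx, y, hy, hxy, (levelMap_of_mem_JTail_succ hx1).2,
      (levelMap_of_mem_JTail_succ hy1).2⟩ h
  have gap : ∀ x ∈ α, ¬ (2 < InfQuant.levelMap (m + 1) x ∧ InfQuant.levelMap (m + 1) x < 3) :=
    fun x hx => not_mem_gap_levelMap h (k := m + 1) (fun _ => pair) hb hx
  have gap' : ∀ x ∈ α, ¬ (2 < InfQuant.levelMap m x ∧ InfQuant.levelMap m x < 3) := by
    refine fun x hx => not_mem_gap_levelMap h (fun hm => ?_) (pair.exists_mem_J h) hx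
    obtain ⟨l, rfl⟩ : ∃ l, m = l + 1 := ⟨m - 1, by omega⟩
    exact pair.of_succ
  obtain ⟨ρ, hρ, h0, hm⟩ := h.exists_level (m + 1)
  have hd := isServedRight_levelMap h (k := m + 1) (fun _ => pair) hρ h0
  rw [if_neg m.succ_ne_zero] at hm
  set β := α.image (InfQuant.levelMap (m + 1)) with hβ
  have mem : ∀ {x}, x ∈ α → InfQuant.levelMap (m + 1) x ∈ β := fun hx =>
    Finset.mem_image_of_mem _ hx
  have hb' : ∃ p ∈ β, 3 ≤ p ∧ p ≤ 4 := by
    obtain ⟨b, hb, h34⟩ := hb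
    exact ⟨_, mem hb, h34⟩
  have hgap : ∀ p ∈ β, p ≤ 2 ∨ 3 ≤ p := fun p hp => by
    obtain ⟨z, hz, rfl⟩ := Finset.mem_image.1 hp
    by_contra! hcon
    exact gap z hz hcon
  -- The interval (4, 6) at this level is the gap (2, 3) of the preceding one.
  have hgap' : ∀ p ∈ β, p ≤ 4 ∨ 6 ≤ p := fun p hp => by
    obtain ⟨z, hz, rfl⟩ := Finset.mem_image.1 hp
    by_contra! hcon
    rw [levelMap_succ] at hcon
    exact gap' z hz ⟨by linarith, by linarith⟩
  have hne := (levelMap_injective (m + 1)).ne hxy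
  have bx := levelMap_of_mem_JTail hxJ
  have bY := levelMap_of_mem_JTail hyJ
  have hu := hm.exists_mem_upper_tail hρ hd hb' hgap hgap'
    ⟨_, mem hx, _, mem hy, hne, bx.1, bx.2, bY.1, bY.2⟩
  have hZ : ∀ {z}, z ∈ JTail (m + 1) →
      InfQuant.levelMap (m + 1) z ∈ InfQuant.levelMap (m + 1) '' JTail (m + 1 + 1) ∨
        3 ≤ InfQuant.levelMap (m + 1) z ∧ InfQuant.levelMap (m + 1) z ≤ 4 := fun {z} hz => by
    rcases mem_JTail_or hz with h | h
    · exact Or.inr ((mem_J_iff _ _).1 h)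
    · exact Or.inl ⟨z, h, rfl⟩
  refine ⟨?_, ?_, ?_, gap⟩
  · obtain ⟨p, hp, h34⟩ := hm.exists_mem_block_lt hρ hd hb' hgap
    obtain ⟨z, hz, rfl⟩ := Finset.mem_image.1 hp
    exact ⟨z, hz, h34⟩
  · obtain ⟨p, hp, h12⟩ := hu
    obtain ⟨z, hz, rfl⟩ := Finset.mem_image.1 hp
    exact ⟨z, hz, h12⟩
  · obtain ⟨p, hp, w, hw, hwp⟩ := hm.exists_mem_tail hρ hd hb' hgap hu
      (Icc_subset_levelMap_image (m + 1)) ⟨_, mem hx, _, mem hy, hne, hZ hxJ, hZ hyJ⟩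
    obtain ⟨z, hz, rfl⟩ := Finset.mem_image.1 hp
    exact ⟨z, hz, levelMap_injective _ hwp ▸ hw⟩

lemma abs_levelMap_sub (k : ℕ) (x y : ℝ) :
    |levelMap k x - levelMap k y| = 2 ^ (k + 2) * |x - y| := by
  have e : levelMap k x - levelMap k y = -(2 ^ (k + 2) * (x - y)) := by unfold levelMap; ring
  rw [e, abs_neg, abs_mul, abs_of_pos (by positivity)]

lemma abs_levelMap_sub_le_of_mem_voronoi {k : ℕ} {a b x : ℝ} (hb : b ∈ α)
    (hx : x ∈ voronoi α a) :
    |levelMap k x - levelMap k a| ≤ |levelMap k x - levelMap k b| := by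
  rw [abs_levelMap_sub, abs_levelMap_sub]
  exact mul_le_mul_of_nonneg_left (hx b hb) (by positivity)

end

end InfQuant

/-! ### The proposition in the original coordinate -/

theorem proposition2 (k n : ℕ) (hk : 1 ≤ k) (hn : 1 ≤ n) (α : Finset ℝ)
    (hα : InfQuant.IsOptimalSet InfQuant.P n α)
    (hcard : 2 ≤ ((α : Set ℝ) ∩ InfQuant.JTail k).ncard) :
    ((α : Set ℝ) ∩ InfQuant.J (k + 1)).Nonempty ∧
    ((α : Set ℝ) ∩ InfQuant.JTail (k + 1)).Nonempty ∧
    (α : Set ℝ) ∩ Set.Ioo (InfQuant.S (k + 1) 1) (InfQuant.S (k + 2) 0) = ∅ ∧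
    (∀ a ∈ (α : Set ℝ) ∩ InfQuant.J (k + 1),
      InfQuant.voronoi α a ∩ InfQuant.JTail (k + 1) = ∅) ∧
    (∀ a ∈ (α : Set ℝ) ∩ InfQuant.JTail (k + 1),
      InfQuant.voronoi α a ∩ InfQuant.J (k + 1) = ∅) := by
  obtain ⟨x, y, hx, hy, hxy⟩ :=
    (Set.one_lt_ncard_iff (α.finite_toSet.inter_of_left _)).1 hcard
  obtain ⟨⟨b, hb, hb3, hb4⟩, ⟨c, hc, hc1, hc2⟩, ⟨d, hd, hdJ⟩, gap⟩ :=
    hα.isMinimizer.levelMap_points hk ⟨x, hx.1, y, hy.1, hxy, hx.2, hy.2⟩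
  refine ⟨⟨b, hb, (InfQuant.mem_J_iff k b).2 ⟨hb3, hb4.le⟩⟩, ⟨d, hd, hdJ⟩, ?_, ?_, ?_⟩
  · refine Set.eq_empty_iff_forall_notMem.2 fun z hz => gap z hz.1 ?_
    have hp : (0 : ℝ) < 2 ^ k := by positivity
    have e1 : InfQuant.S (k + 1) 1 = 1 - 3 / 2 ^ (k + 2) := by
      simp only [InfQuant.S, Nat.add_sub_cancel, pow_succ]
      field_simp
      ring
    have e2 : InfQuant.S (k + 2) 0 = 1 - 2 / 2 ^ (k + 2) := by
      simp only [InfQuant.S, show k + 2 - 1 = k + 1 by omega, pow_succ]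
      field_simp
      ring
    have h1 := hz.2.1
    have h2 := hz.2.2
    rw [e1, sub_lt_comm, lt_div_iff₀ (by positivity)] at h1
    rw [e2, lt_sub_comm, div_lt_iff₀ (by positivity)] at h2
    unfold InfQuant.levelMap
    constructor <;> linarith
  -- In level coordinates z ≤ 2, a ≥ 3 and 1 < c ≤ 2, so z - c < 1 ≤ a - z and c - z < a - z: c is
  -- strictly nearer to z than a is.
  · rintro a ⟨ha, haJ⟩
    refine Set.eq_empty_iff_forall_notMem.2 fun z hz => ?_
    have h1 := InfQuant.abs_levelMap_sub_le_of_mem_voronoi (k := k) hc hz.1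
    have h2 := InfQuant.levelMap_of_mem_JTail_succ hz.2
    have h3 := (InfQuant.mem_J_iff k a).1 haJ
    rw [abs_of_neg (by linarith)] at h1
    rcases le_abs.1 h1 with h | h <;> linarith
  -- Here z and b lie in [3, 4] with b < 4, and a ≤ 2, so b - z < 1 ≤ z - a and z - b < z - a.
  · rintro a ⟨ha, haJ⟩
    refine Set.eq_empty_iff_forall_notMem.2 fun z hz => ?_
    have h1 := InfQuant.abs_levelMap_sub_le_of_mem_voronoi (k := k) hb hz.1
    have h2 := InfQuant.levelMap_of_mem_JTail_succ haJ
    have h3 := (InfQuant.mem_J_iff k z).1 hz.2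
    rw [abs_of_pos (by linarith)] at h1
    rcases le_abs.1 h1 with h | h <;> linarith
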